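/- Let $(\epsilon_k)_{k\ge 0}$ be a strictly decreasing sequence of positive reals converging to $0$ with $\epsilon_0<1$; put $\epsilon_{-1}=1$ and assume $$\frac{\epsilon_{k-1}-\epsilon_k}{\epsilon_{k-2}-\epsilon_{k-1}}<1\qquad\text{for all }k\ge 1 .$$ Let $L:[0,1]\to[0,1]$ be the piecewise linear map with $L(0)=0$, $$L(x)=\frac{\epsilon_{k-2}-\epsilon_{k-1}}{\epsilon_{k-1}-\epsilon_k}\,(x-\epsilon_k)+\epsilon_{k-1}\quad(\epsilon_k<x\le\epsilon_{k-1},\ k\ge1),\qquad L(x)=\frac{x-\epsilon_0}{1-\epsilon_0}\quad(\epsilon_0<x\le1).$$ Let $m$ be Lebesgue measure on $[0,1]$. For $x\in[0,1]$ let $\omega=\omega(x)\in\{0,1\}^{\mathbb N}$ be its symbolic orbit with respect to $I_0=[0,\epsilon_0]$, $I_1=(\epsilon_0,1]$, that is, $L^i(x)\in I_{\omega_i}$ for all $i\ge0$. Let $$N_n=\#\{0\le i\le n-1:\ \omega_i\neq0\}$$ be the number of passages through $I_1$ in the first $n$ steps, and let $\mathbb E[N_n]=\int_0^1 N_n\,dm$.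 Let $$t_0=\sum_{k=1}^{\infty}k\,(\epsilon_{k-2}-\epsilon_{k-1})\in(0,\infty],\qquad F(x)=\sum_{r=1}^{\lfloor x\rfloor}(\epsilon_{r-2}-\epsilon_{r-1})$$ be the mean recurrence time to $I_1$ and the distribution function of the recurrence time. Write $f\sim g$ if $f/g\to1$. Then: 1. If $t_0<\infty$, then $\mathbb E[N_n]\sim n/t_0$ as $n\to\infty$. 2. If $t_0=\infty$, then $\mathbb E[N_n]\to\infty$ and $\mathbb E[N_n]=o(n)$. 3. Suppose that $1-F(x)\sim A x^{-\alpha}$ as $x\to\infty$, with real constants $A$ (necessarily positive) and $\alpha$. - If $\alpha>1$, then $t_0<\infty$. - If $0<\alpha<1$, then $t_0=\infty$ and $$\mathbb E[N_n]\sim\frac{\sin(\alpha\pi)}{A\alpha\pi}\,n^{\alpha};$$ moreover, for every real sequence $(b_n)$ with $b_n=o(\mathbb E[N_n])$, $m(\{N_n\le b_n\})\to0$ as $n\to\infty$. 4. If $1-F(x)\sim 1/\log x$ as $x\to\infty$, then $t_0=\infty$ and $\mathbb E[N_n]\sim\log n$. -/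

import Mathlib

open MeasureTheory Filter Topology Asymptotics

noncomputable section

namespace PL

/-- `pt ε j` is `ε_{j-1}`, with the convention `ε_{-1} = 1`. -/
def pt (ε : ℕ → ℝ) : ℕ → ℝ
  | 0 => 1
  | j + 1 => ε j

/-- The sequences `ε_0 > ε_1 > …` that define PL maps. The inequality `ε_0 < ε_{-1} = 1` is part of
the monotonicity, and the last field is
`(ε_{k-1} - ε_k) / (ε_{k-2} - ε_{k-1}) < 1` for `k ≥ 1` (written here for `k + 1`). -/
structure IsPLSeq (ε : ℕ → ℝ) : Prop where
  pos : ∀ k, 0 < ε k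
  strictAnti : StrictAnti ε
  lt_one : ε 0 < 1
  tendsto_zero : Tendsto ε atTop (𝓝 0)
  ratio_lt_one : ∀ k, (pt ε (k + 1) - pt ε (k + 2)) / (pt ε k - pt ε (k + 1)) < 1

open Classical in
/-- The PL map on `[0,1]` (it takes values in `[0,1]` there, see `mapsTo_plMap`). The `k` found in
the middle branch is unique. The last branch is only reached on `[0,1]` at `x = 0`. -/
def plMap (ε : ℕ → ℝ) (x : ℝ) : ℝ :=
  if ε 0 < x then (x - ε 0) / (1 - ε 0)
  else if h : ∃ k, 1 ≤ k ∧ pt ε (k + 1) < x ∧ x ≤ pt ε k then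
    (pt ε (Nat.find h - 1) - pt ε (Nat.find h)) / (pt ε (Nat.find h) - pt ε (Nat.find h + 1))
      * (x - pt ε (Nat.find h + 1)) + pt ε (Nat.find h)
  else 0

/-- The symbolic orbit of `x` for the partition `I_0 = [0, ε_0]`, `I_1 = (ε_0, 1]`. -/
def symb (ε : ℕ → ℝ) (x : ℝ) (i : ℕ) : Fin 2 :=
  open Classical in if (plMap ε)^[i] x ∈ Set.Icc 0 (ε 0) then 0 else 1

/-- `N_n(ω) = #{i | ω_i ≠ 0, i = 0, …, n-1}`. -/
def passages (n : ℕ) (ω : ℕ → Fin 2) : ℕ :=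
  ((Finset.range n).filter fun i => ω i ≠ 0).card

/-- Lebesgue measure on `[0,1]`. -/
def leb : Measure ℝ := volume.restrict (Set.Icc 0 1)

/-- `E[N_n]`, the expectation with respect to Lebesgue measure on `[0,1]`. -/
def meanPassages (ε : ℕ → ℝ) (n : ℕ) : ℝ :=
  ∫ x, (passages n (symb ε x) : ℝ) ∂leb

/-- The mean recurrence time `t_0 = ∑_{k ≥ 1} k (ε_{k-2} - ε_{k-1}) ∈ [0,∞]` of `I_1`
(the summation index here is `k - 1`). -/
def meanRecurrenceTime (ε : ℕ → ℝ) : ENNReal :=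
  ∑' k : ℕ, ENNReal.ofReal (((k : ℝ) + 1) * (pt ε k - pt ε (k + 1)))

/-- `F(x) = ∑_{r=1}^{⌊x⌋} (ε_{r-2} - ε_{r-1})`, the distribution function of the recurrence time. -/
def recurrenceCDF (ε : ℕ → ℝ) (x : ℝ) : ℝ :=
  ∑ r ∈ Finset.Icc 1 ⌊x⌋₊, (pt ε (r - 1) - pt ε r)

lemma IsPLSeq.strictAnti_pt {ε : ℕ → ℝ} (h : IsPLSeq ε) : StrictAnti (pt ε) := by
  refine strictAnti_nat_of_succ_lt fun n => ?_
  cases n with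
  | zero => exact h.lt_one
  | succ n => exact h.strictAnti (Nat.lt_succ_self n)

lemma plMap_of_lt {ε : ℕ → ℝ} {x : ℝ} (hx : ε 0 < x) :
    plMap ε x = (x - ε 0) / (1 - ε 0) := by
  simp [plMap, hx]

/-- The branch on `(ε_k, ε_{k-1}]`, `k ≥ 1`. -/
lemma plMap_of_mem {ε : ℕ → ℝ} (h : IsPLSeq ε) {k : ℕ} (hk : 1 ≤ k) {x : ℝ}
    (h1 : pt ε (k + 1) < x) (h2 : x ≤ pt ε k) :
    plMap ε x = (pt ε (k - 1) - pt ε k) / (pt ε k - pt ε (k + 1)) * (x - pt ε (k + 1))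
      + pt ε k := by
  classical
  have hx : ¬ ε 0 < x := not_lt.2 (h2.trans (h.strictAnti_pt.antitone hk))
  have hex : ∃ k, 1 ≤ k ∧ pt ε (k + 1) < x ∧ x ≤ pt ε k := ⟨k, hk, h1, h2⟩
  have hf : Nat.find hex = k := by
    obtain ⟨-, g1, g2⟩ := Nat.find_spec hex
    have a1 := h.strictAnti_pt.lt_iff_gt.1 (h1.trans_le g2)
    have a2 := h.strictAnti_pt.lt_iff_gt.1 (g1.trans_le h2)
    omega
  rw [plMap, if_neg hx, dif_pos hex, hf]

lemma plMap_zero {ε : ℕ → ℝ} (h : IsPLSeq ε) : plMap ε 0 = 0 := by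
  have hex : ¬ ∃ k, 1 ≤ k ∧ pt ε (k + 1) < 0 ∧ 0 ≤ pt ε k := by
    rintro ⟨k, -, h1, -⟩
    exact absurd (h.pos k) (not_lt.2 (le_of_lt h1))
  rw [plMap, if_neg (not_lt.2 (h.pos 0).le), dif_neg hex]

lemma mapsTo_plMap {ε : ℕ → ℝ} (h : IsPLSeq ε) :
    Set.MapsTo (plMap ε) (Set.Icc 0 1) (Set.Icc 0 1) := by
  classical
  rintro x ⟨hx0, hx1⟩
  have h0 := h.lt_one
  by_cases hx : ε 0 < x
  · rw [plMap_of_lt hx]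
    exact ⟨div_nonneg (by linarith) (by linarith), (div_le_one (by linarith)).2 (by linarith)⟩
  by_cases hex : ∃ k, 1 ≤ k ∧ pt ε (k + 1) < x ∧ x ≤ pt ε k
  · obtain ⟨k, hk, h1, h2⟩ := hex
    rw [plMap_of_mem h hk h1 h2]
    obtain ⟨j, rfl⟩ : ∃ j, k = j + 1 := ⟨k - 1, by omega⟩
    have a1 : pt ε (j + 1) < pt ε j := h.strictAnti_pt (Nat.lt_succ_self j)
    have a2 : pt ε (j + 1 + 1) < pt ε (j + 1) := h.strictAnti_pt (Nat.lt_succ_self _)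
    have a3 : pt ε j ≤ 1 := h.strictAnti_pt.antitone (Nat.zero_le j)
    have a4 : 0 < pt ε (j + 1) := h.pos j
    have a5 : (x - pt ε (j + 1 + 1)) / (pt ε (j + 1) - pt ε (j + 1 + 1)) ≤ 1 :=
      (div_le_one (by linarith)).2 (by linarith)
    have a6 : 0 ≤ (x - pt ε (j + 1 + 1)) / (pt ε (j + 1) - pt ε (j + 1 + 1)) :=
      div_nonneg (by linarith) (by linarith)
    have e : (pt ε (j + 1 - 1) - pt ε (j + 1)) / (pt ε (j + 1) - pt ε (j + 1 + 1))
        * (x - pt ε (j + 1 + 1)) = (pt ε j - pt ε (j + 1)) *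
        ((x - pt ε (j + 1 + 1)) / (pt ε (j + 1) - pt ε (j + 1 + 1))) := by
      rw [Nat.add_sub_cancel]; ring
    rw [e]
    constructor <;> nlinarith
  · rw [plMap, if_neg hx, dif_neg hex]
    simp

end PL

end

noncomputable section

namespace PL

/-! Each branch is affine: the interval with index `k + 1` is carried onto the one with index `k`,
and `I_1` onto `(0,1]`. Under Lebesgue measure the first visit to `I_1` therefore occurs at time `k`
with probability `gap ε k`, and the orbit then restarts from the uniform law
(`integral_visits_piece`, `integral_visits_renewal`). So `N_n` counts renewals with recurrence time
`R`, where `P(R > k) = pt ε k`.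

Put `U_n = 1 + E[N_n]` and `T_n = E[min(R, n)]`. The renewal equation sums to `∑ pt k * U_{n-k} = n
+ 1`. As `U` is monotone, `n ≤ T_n U_n` and `T_M U_n ≤ n + M + 1`, whence `U_n / n → 1 / t_0`, the
limit being `0` if `t_0 = ∞` (`tendsto_renewalSum_div`). The bound on `P(N_n < j)` uses `E[min(S_j,
M)] ≤ j T_M` for the sum `S_j` of `j` recurrence times (`visitsCDF_le`).

For `0 < α < 1`, the Laplace transforms of `pt` and of the renewal sequence have product `1 / (1 -
e^{-r})`. An Abelian theorem treats the first, Karamata's Tauberian theorem inverts the second, and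
Euler's reflection formula gives the constant (`tendsto_renewalSum_div_rpow`). For a logarithmic
tail, `pt n * U_n ≤ 1` and `n ≤ T_n U_n` already suffice. -/

/-! ### Measurability of the map and of the visit counts. -/

/-- The length of the interval `(ε_k, ε_{k-1}]`. -/
def gap (ε : ℕ → ℝ) (k : ℕ) : ℝ := pt ε k - pt ε (k + 1)

/-- Number of visits of the orbit of `x` to `I_1` before time `n`. -/
def visits (ε : ℕ → ℝ) (n : ℕ) (x : ℝ) : ℕ := passages n (symb ε x)

lemma IsPLSeq.pt_pos {ε : ℕ → ℝ} (h : IsPLSeq ε) (k : ℕ) : 0 < pt ε k := by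
  cases k with
  | zero => exact one_pos
  | succ k => exact h.pos k

lemma IsPLSeq.pt_le_one {ε : ℕ → ℝ} (h : IsPLSeq ε) (k : ℕ) : pt ε k ≤ 1 :=
  h.strictAnti_pt.antitone (Nat.zero_le k)

lemma IsPLSeq.tendsto_pt {ε : ℕ → ℝ} (h : IsPLSeq ε) : Tendsto (pt ε) atTop (𝓝 0) :=
  (tendsto_add_atTop_iff_nat 1).1 h.tendsto_zero

lemma IsPLSeq.gap_pos {ε : ℕ → ℝ} (h : IsPLSeq ε) (k : ℕ) : 0 < gap ε k :=
  sub_pos.2 (h.strictAnti_pt (Nat.lt_succ_self k))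

lemma measurable_plMap {ε : ℕ → ℝ} (h : IsPLSeq ε) : Measurable (plMap ε) := by
  intro s hs
  set f : ℕ → ℝ → ℝ := fun k x => (pt ε k - pt ε (k + 1)) / (pt ε (k + 1) - pt ε (k + 2))
    * (x - pt ε (k + 2)) + pt ε (k + 1) with hf
  have hfm : ∀ k, Measurable (f k) := fun k => by fun_prop
  have hgm : Measurable fun x : ℝ => (x - ε 0) / (1 - ε 0) := by fun_prop
  -- The preimage splits along the branches; the last piece collects the points where the map takes
  -- its default value `0`.
  have key : plMap ε ⁻¹' s = (Set.Ioi (ε 0) ∩ (fun x : ℝ => (x - ε 0) / (1 - ε 0)) ⁻¹' s) ∪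
      (⋃ k, Set.Ioc (pt ε (k + 2)) (pt ε (k + 1)) ∩ f k ⁻¹' s) ∪
      ((Set.Ioi (ε 0) ∪ ⋃ k, Set.Ioc (pt ε (k + 2)) (pt ε (k + 1)))ᶜ ∩
        (fun _ : ℝ => (0 : ℝ)) ⁻¹' s) := by
    ext x
    by_cases hx : ε 0 < x
    · have : ∀ k, ¬ x ≤ pt ε (k + 1) := fun k => not_le.2
        ((h.strictAnti_pt.antitone (Nat.le_add_left 1 k)).trans_lt hx)
      simp [plMap_of_lt hx, hx, this]
    by_cases hex : ∃ k, x ∈ Set.Ioc (pt ε (k + 2)) (pt ε (k + 1))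
    · obtain ⟨k, hk⟩ := hex
      have e : plMap ε x = f k x := plMap_of_mem h (Nat.le_add_left 1 k) hk.1 hk.2
      have u : ∀ j, x ∈ Set.Ioc (pt ε (j + 2)) (pt ε (j + 1)) → j = k := by
        intro j hj
        have a1 := h.strictAnti_pt.lt_iff_gt.1 (hk.1.trans_le hj.2)
        have a2 := h.strictAnti_pt.lt_iff_gt.1 (hj.1.trans_le hk.2)
        omega
      simp only [Set.mem_preimage, Set.mem_union, Set.mem_inter_iff, Set.mem_iUnion,
        Set.mem_compl_iff, e]
      constructor
      · exact fun hs => Or.inl (Or.inr ⟨k, hk, hs⟩)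
      · rintro ((⟨h1, -⟩ | ⟨j, hj, hjs⟩) | ⟨h1, -⟩)
        · exact absurd h1 hx
        · rwa [u j hj] at hjs
        · exact absurd (Or.inr ⟨k, hk⟩) h1
    · have e : plMap ε x = 0 := by
        rw [plMap, if_neg hx, dif_neg]
        rintro ⟨k, hk, h1, h2⟩
        obtain ⟨j, rfl⟩ : ∃ j, k = j + 1 := ⟨k - 1, by omega⟩
        exact hex ⟨j, h1, h2⟩
      simp only [Set.mem_preimage, Set.mem_union, Set.mem_inter_iff, Set.mem_iUnion,
        Set.mem_compl_iff, e]
      constructor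
      · exact fun hs => Or.inr ⟨fun h' => h'.elim hx hex, hs⟩
      · rintro ((⟨h1, -⟩ | ⟨j, hj, -⟩) | ⟨-, h1⟩)
        · exact absurd h1 hx
        · exact absurd ⟨j, hj⟩ hex
        · exact h1
  rw [key]
  refine ((measurableSet_Ioi.inter (hgm hs)).union (MeasurableSet.iUnion fun k =>
    measurableSet_Ioc.inter (hfm k hs))).union ?_
  exact (measurableSet_Ioi.union (MeasurableSet.iUnion fun k => measurableSet_Ioc)).compl.inter
    (measurable_const hs)

lemma visits_succ (ε : ℕ → ℝ) (n : ℕ) (x : ℝ) :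
    visits ε (n + 1) x =
      (if symb ε x 0 ≠ 0 then 1 else 0) + visits ε n (plMap ε x) := by
  have e : ∀ i, symb ε x (i + 1) = symb ε (plMap ε x) i := fun i => by
    simp [symb, Function.iterate_succ_apply]
  simp only [visits, passages, Finset.card_filter, Finset.sum_range_succ', e]
  rw [add_comm]

lemma visits_succ_of_le {ε : ℕ → ℝ} (n : ℕ) {x : ℝ} (h0 : 0 ≤ x) (hx : x ≤ ε 0) :
    visits ε (n + 1) x = visits ε n (plMap ε x) := by
  simp [visits_succ, symb, h0, hx]

lemma visits_succ_of_lt {ε : ℕ → ℝ} (n : ℕ) {x : ℝ} (hx : ε 0 < x) :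
    visits ε (n + 1) x = 1 + visits ε n (plMap ε x) := by
  simp [visits_succ, symb, hx]

lemma visits_mono (ε : ℕ → ℝ) (x : ℝ) : Monotone fun n => visits ε n x := fun _ _ h =>
  Finset.card_le_card (Finset.filter_subset_filter _ (Finset.range_mono h))

lemma visits_le (ε : ℕ → ℝ) (n : ℕ) (x : ℝ) : visits ε n x ≤ n :=
  (Finset.card_filter_le _ _).trans (Finset.card_range n).le

lemma measurable_visits {ε : ℕ → ℝ} (h : IsPLSeq ε) (n : ℕ) : Measurable (visits ε n) := by
  induction n with
  | zero => exact measurable_const (a := 0)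
  | succ n ih =>
    have e : visits ε (n + 1) = fun x => (if x ∈ Set.Icc 0 (ε 0) then 0 else 1) +
        visits ε n (plMap ε x) := by
      ext x
      rw [visits_succ]
      by_cases hx : x ∈ Set.Icc 0 (ε 0) <;> simp [symb, hx]
    rw [e]
    exact (Measurable.ite measurableSet_Icc measurable_const measurable_const).add
      (ih.comp (measurable_plMap h))

/-- A function of the number of visits is integrable on every bounded interval. -/
lemma intervalIntegrable_visits {ε : ℕ → ℝ} (h : IsPLSeq ε) (g : ℕ → ℝ) (n : ℕ) (a b : ℝ) :
    IntervalIntegrable (fun x => g (visits ε n x)) volume a b := by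
  -- At most `n` visits occur, so `g` is evaluated at finitely many points and the sum of all their
  -- norms is a bound.
  have hb : ∀ x, ‖g (visits ε n x)‖ ≤ ∑ i ∈ Finset.range (n + 1), ‖g i‖ := fun x =>
    Finset.single_le_sum (f := fun i => ‖g i‖) (fun _ _ => norm_nonneg _)
      (Finset.mem_range.2 (Nat.lt_succ_of_le (visits_le ε n x)))
  have hm : Measurable fun x => g (visits ε n x) :=
    (measurable_of_countable g).comp (measurable_visits h n)
  refine (intervalIntegrable_const (c := ∑ i ∈ Finset.range (n + 1), ‖g i‖)).mono_fun
    hm.aestronglyMeasurable (Eventually.of_forall fun x => ?_)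
  exact (hb x).trans (le_abs_self _)

/-! ### The renewal structure under Lebesgue measure. -/

lemma integral_comp_plMap_zero {ε : ℕ → ℝ} (h : IsPLSeq ε) (g : ℝ → ℝ) :
    ∫ x in pt ε 1..pt ε 0, g (plMap ε x) = gap ε 0 * ∫ x in (0 : ℝ)..1, g x := by
  have h1 : pt ε 1 ≤ pt ε 0 := h.strictAnti_pt.antitone (Nat.zero_le 1)
  have hc : gap ε 0 ≠ 0 := (h.gap_pos 0).ne'
  have e : ∫ x in pt ε 1..pt ε 0, g (plMap ε x) =
      ∫ x in pt ε 1..pt ε 0, g (x / gap ε 0 - pt ε 1 / gap ε 0) := by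
    refine intervalIntegral.integral_congr_ae (Eventually.of_forall fun x hx => ?_)
    rw [Set.uIoc_of_le h1] at hx
    have : plMap ε x = (x - pt ε 1) / gap ε 0 := plMap_of_lt hx.1
    simp only [this, sub_div]
  rw [e, intervalIntegral.integral_comp_div_sub (fun x => g x) hc, smul_eq_mul]
  congr 2
  · ring
  · rw [← sub_div]; exact div_self hc

/-- The branch is an affine bijection onto the neighbouring interval, so the change of variables
costs only the ratio of lengths. These ratios telescope along an excursion to `I_1`. -/
lemma integral_comp_plMap_succ {ε : ℕ → ℝ} (h : IsPLSeq ε) (g : ℝ → ℝ) (k : ℕ) :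
    ∫ x in pt ε (k + 2)..pt ε (k + 1), g (plMap ε x) =
      gap ε (k + 1) / gap ε k * ∫ x in pt ε (k + 1)..pt ε k, g x := by
  have h1 : pt ε (k + 2) ≤ pt ε (k + 1) := h.strictAnti_pt.antitone (Nat.le_succ _)
  have hc : gap ε k ≠ 0 := (h.gap_pos k).ne'
  have hc' : gap ε (k + 1) ≠ 0 := (h.gap_pos (k + 1)).ne'
  set d := gap ε k / gap ε (k + 1) * (- pt ε (k + 2)) + pt ε (k + 1) with hd
  have e : ∫ x in pt ε (k + 2)..pt ε (k + 1), g (plMap ε x) =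
      ∫ x in pt ε (k + 2)..pt ε (k + 1), g (gap ε k / gap ε (k + 1) * x + d) := by
    refine intervalIntegral.integral_congr_ae (Eventually.of_forall fun x hx => ?_)
    rw [Set.uIoc_of_le h1] at hx
    have : plMap ε x = gap ε k / gap ε (k + 1) * (x - pt ε (k + 2)) + pt ε (k + 1) :=
      plMap_of_mem h (Nat.le_add_left 1 k) hx.1 hx.2
    simp only [this, hd]
    congr 1
    ring
  rw [e, intervalIntegral.integral_comp_mul_add (fun x => g x) (div_ne_zero hc hc'), smul_eq_mul,
    inv_div]
  congr 2
  · rw [hd]; ring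
  · have : gap ε k / gap ε (k + 1) * (pt ε (k + 1) - pt ε (k + 2)) = gap ε k :=
      div_mul_cancel₀ _ hc'
    have e2 : gap ε k = pt ε k - pt ε (k + 1) := rfl
    rw [hd]
    linear_combination this + e2

/-- Conditionally on the first visit to `I_1` taking place at time `k`, the orbit starts afresh
from the uniform distribution at time `k + 1`. -/
lemma integral_visits_piece {ε : ℕ → ℝ} (h : IsPLSeq ε) (g : ℕ → ℝ) (k n : ℕ) :
    ∫ x in pt ε (k + 1)..pt ε k, g (visits ε (n + k + 1) x) =
      gap ε k * ∫ x in (0 : ℝ)..1, g (1 + visits ε n x) := by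
  induction k with
  | zero =>
    rw [← integral_comp_plMap_zero h (fun x => g (1 + visits ε n x))]
    refine intervalIntegral.integral_congr_ae (Eventually.of_forall fun x hx => ?_)
    rw [Set.uIoc_of_le (h.strictAnti_pt.antitone (Nat.zero_le 1))] at hx
    simp only [add_zero]
    rw [visits_succ_of_lt n hx.1]
  | succ k ih =>
    have hc : gap ε k ≠ 0 := (h.gap_pos k).ne'
    have : ∫ x in pt ε (k + 2)..pt ε (k + 1), g (visits ε (n + (k + 1) + 1) x) =
        ∫ x in pt ε (k + 2)..pt ε (k + 1), g (visits ε (n + k + 1) (plMap ε x)) := by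
      refine intervalIntegral.integral_congr_ae (Eventually.of_forall fun x hx => ?_)
      rw [Set.uIoc_of_le (h.strictAnti_pt.antitone (Nat.le_succ _))] at hx
      have h2 : x ≤ ε 0 := hx.2.trans (h.strictAnti_pt.antitone (Nat.le_add_left 1 k))
      have h0 : 0 ≤ x := (h.pt_pos _).le.trans hx.1.le
      rw [visits_succ_of_le _ h0 h2]
      rfl
    rw [this, integral_comp_plMap_succ h (fun x => g (visits ε (n + k + 1) x)), ih, ← mul_assoc,
      div_mul_cancel₀ _ hc]

/-- Below `ε_0`, one step moves a point only one interval to the right, so from `(0, pt ε n]` the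
orbit needs at least `n` steps to reach `I_1`. -/
lemma visits_eq_zero {ε : ℕ → ℝ} (h : IsPLSeq ε) (n : ℕ) {x : ℝ} (h0 : 0 < x)
    (hx : x ≤ pt ε n) : visits ε n x = 0 := by
  induction n generalizing x with
  | zero => rfl
  | succ n ih =>
    have h1 : x ≤ ε 0 := hx.trans (h.strictAnti_pt.antitone (Nat.le_add_left 1 n))
    rw [visits_succ_of_le n h0.le h1]
    have hex : ∃ k, pt ε k < x :=
      (h.tendsto_pt.eventually (gt_mem_nhds h0)).exists
    classical
    obtain ⟨m, hm, hm'⟩ : ∃ m, pt ε (m + 1) < x ∧ x ≤ pt ε m := by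
      have hne : Nat.find hex ≠ 0 := fun h' => by
        have := Nat.find_spec hex
        rw [h'] at this
        exact absurd (hx.trans (h.pt_le_one _)) (not_le.2 this)
      obtain ⟨m, hm⟩ := Nat.exists_eq_succ_of_ne_zero hne
      refine ⟨m, ?_, not_lt.1 (Nat.find_min hex (by omega))⟩
      have := Nat.find_spec hex
      rwa [hm] at this
    have hlt : n + 1 < m + 1 := h.strictAnti_pt.lt_iff_gt.1 (hm.trans_le hx)
    obtain ⟨j, rfl⟩ : ∃ j, m = j + 1 := ⟨m - 1, by omega⟩
    have e : plMap ε x = gap ε j / gap ε (j + 1) * (x - pt ε (j + 2)) + pt ε (j + 1) :=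
      plMap_of_mem h (Nat.le_add_left 1 j) hm hm'
    have p1 := h.gap_pos j
    have p2 := h.gap_pos (j + 1)
    have b0 : 0 ≤ gap ε j / gap ε (j + 1) * (x - pt ε (j + 2)) :=
      mul_nonneg (div_pos p1 p2).le (sub_pos.2 hm).le
    have b1 : gap ε j / gap ε (j + 1) * (x - pt ε (j + 2)) ≤ gap ε j := by
      calc _ ≤ gap ε j / gap ε (j + 1) * gap ε (j + 1) := by
            refine mul_le_mul_of_nonneg_left ?_ (div_pos p1 p2).le
            exact sub_le_sub_right hm' _
        _ = gap ε j := div_mul_cancel₀ _ p2.ne'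
    have e2 : gap ε j = pt ε j - pt ε (j + 1) := rfl
    refine ih ?_ ?_
    · rw [e]; linarith [h.pt_pos (j + 1)]
    · have : pt ε j ≤ pt ε n := h.strictAnti_pt.antitone (by omega)
      rw [e]; linarith

/-- The renewal equation, tested against an arbitrary function of the number of visits. -/
lemma integral_visits_renewal {ε : ℕ → ℝ} (h : IsPLSeq ε) (g : ℕ → ℝ) (n : ℕ) :
    ∫ x in (0 : ℝ)..1, g (visits ε n x) = g 0 * pt ε n +
      ∑ k ∈ Finset.range n, gap ε k * ∫ x in (0 : ℝ)..1, g (1 + visits ε (n - 1 - k) x) := by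
  have hi := intervalIntegrable_visits h g n
  have e1 : ∑ k ∈ Finset.range n, gap ε k * ∫ x in (0 : ℝ)..1, g (1 + visits ε (n - 1 - k) x) =
      ∫ x in pt ε n..1, g (visits ε n x) := by
    have := intervalIntegral.sum_integral_adjacent_intervals (μ := volume)
      (f := fun x => g (visits ε n x)) (a := pt ε) (n := n) (fun k _ => hi _ _)
    rw [intervalIntegral.integral_symm, show (1 : ℝ) = pt ε 0 from rfl, ← this,
      ← Finset.sum_neg_distrib]
    refine Finset.sum_congr rfl fun k hk => ?_
    have hk := Finset.mem_range.1 hk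
    rw [← intervalIntegral.integral_symm, show pt ε 0 = (1 : ℝ) from rfl,
      ← integral_visits_piece h g k (n - 1 - k)]
    congr! 4
    omega
  have e2 : ∫ x in (0 : ℝ)..pt ε n, g (visits ε n x) = g 0 * pt ε n := by
    have : ∫ x in (0 : ℝ)..pt ε n, g (visits ε n x) = ∫ _ in (0 : ℝ)..pt ε n, g 0 := by
      refine intervalIntegral.integral_congr_ae (Eventually.of_forall fun x hx => ?_)
      rw [Set.uIoc_of_le (h.pt_pos n).le] at hx
      rw [visits_eq_zero h n hx.1 hx.2]
    rw [this, intervalIntegral.integral_const, sub_zero, smul_eq_mul, mul_comm]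
  rw [e1, ← e2, intervalIntegral.integral_add_adjacent_intervals (hi _ _) (hi _ _)]

/-! ### The renewal function, the renewal sequence and their convolution identities. -/

lemma integral_leb_eq (f : ℝ → ℝ) : ∫ x, f x ∂leb = ∫ x in (0 : ℝ)..1, f x := by
  rw [leb, integral_Icc_eq_integral_Ioc, intervalIntegral.integral_of_le zero_le_one]

lemma meanPassages_eq (ε : ℕ → ℝ) (n : ℕ) :
    meanPassages ε n = ∫ x in (0 : ℝ)..1, (visits ε n x : ℝ) :=
  integral_leb_eq _

/-- The expected number of renewals up to time `n`, the one at time `0` included. -/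
def renewalSum (ε : ℕ → ℝ) (n : ℕ) : ℝ := 1 + meanPassages ε n

lemma sum_gap (ε : ℕ → ℝ) (n : ℕ) : ∑ k ∈ Finset.range n, gap ε k = 1 - pt ε n :=
  Finset.sum_range_sub' (pt ε) n

lemma renewalSum_eq {ε : ℕ → ℝ} (h : IsPLSeq ε) (n : ℕ) :
    renewalSum ε n = 1 + ∑ k ∈ Finset.range n, gap ε k * renewalSum ε (n - 1 - k) := by
  have e : ∀ m, ∫ x in (0 : ℝ)..1, ((1 + visits ε m x : ℕ) : ℝ) = renewalSum ε m := fun m => by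
    have := intervalIntegrable_visits h (fun i => (i : ℝ)) m 0 1
    simp only [Nat.cast_add, Nat.cast_one]
    rw [intervalIntegral.integral_add intervalIntegrable_const this, renewalSum, meanPassages_eq]
    simp
  have := integral_visits_renewal h (fun i => (i : ℝ)) n
  simp only [e] at this
  rw [renewalSum, meanPassages_eq, this]
  simp

lemma renewalSum_zero (ε : ℕ → ℝ) : renewalSum ε 0 = 1 := by
  simp [renewalSum, meanPassages_eq, visits, passages]

lemma renewalSum_mono {ε : ℕ → ℝ} (h : IsPLSeq ε) : Monotone (renewalSum ε) := fun m n hmn => by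
  rw [renewalSum, renewalSum, meanPassages_eq, meanPassages_eq]
  refine add_le_add_right (intervalIntegral.integral_mono_on zero_le_one
    (intervalIntegrable_visits h (fun i => (i : ℝ)) m 0 1)
    (intervalIntegrable_visits h (fun i => (i : ℝ)) n 0 1) fun x _ => ?_) _
  exact_mod_cast visits_mono ε x hmn

lemma one_le_renewalSum {ε : ℕ → ℝ} (h : IsPLSeq ε) (n : ℕ) : 1 ≤ renewalSum ε n :=
  (renewalSum_zero ε).ge.trans (renewalSum_mono h (Nat.zero_le n))

/-- The probability of fewer than `j` visits to `I_1` before time `n`. -/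
def visitsCDF (ε : ℕ → ℝ) (j n : ℕ) : ℝ :=
  ∫ x in (0 : ℝ)..1, if visits ε n x < j then 1 else 0

lemma visitsCDF_zero (ε : ℕ → ℝ) (n : ℕ) : visitsCDF ε 0 n = 0 := by simp [visitsCDF]

/-- The renewal equation for an indicator: the first visit uses up one of the allowed visits. -/
lemma visitsCDF_succ {ε : ℕ → ℝ} (h : IsPLSeq ε) (j n : ℕ) :
    visitsCDF ε (j + 1) n =
      pt ε n + ∑ k ∈ Finset.range n, gap ε k * visitsCDF ε j (n - 1 - k) := by
  have := integral_visits_renewal h (fun i => if i < j + 1 then 1 else 0) n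
  simpa [visitsCDF, add_comm 1] using this

lemma visitsCDF_nonneg (ε : ℕ → ℝ) (j n : ℕ) : 0 ≤ visitsCDF ε j n :=
  intervalIntegral.integral_nonneg zero_le_one fun x _ => by split_ifs <;> simp

lemma visitsCDF_antitone {ε : ℕ → ℝ} (h : IsPLSeq ε) (j : ℕ) : Antitone (visitsCDF ε j) :=
  fun m n hmn => by
    refine intervalIntegral.integral_mono_on zero_le_one
      (intervalIntegrable_visits h (fun i => if i < j then 1 else 0) n 0 1)
      (intervalIntegrable_visits h (fun i => if i < j then 1 else 0) m 0 1) fun x _ => ?_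
    have := visits_mono ε x hmn
    dsimp only at this
    split_ifs <;> first | omega | simp

lemma leb_setOf_visits_lt {ε : ℕ → ℝ} (h : IsPLSeq ε) (j n : ℕ) :
    leb {x | visits ε n x < j} = ENNReal.ofReal (visitsCDF ε j n) := by
  have hm : MeasurableSet {x | visits ε n x < j} :=
    measurable_visits h n (measurableSet_Iio (a := j))
  have : IsFiniteMeasure leb := by unfold leb; infer_instance
  rw [visitsCDF, ← integral_leb_eq]
  have : (fun x => if visits ε n x < j then (1 : ℝ) else 0) =
      Set.indicator {x | visits ε n x < j} 1 := by
    ext x; simp [Set.indicator_apply]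
  rw [this, integral_indicator_one hm, ofReal_measureReal]

/-- The truncated mean `E[min(R, n)]` of the recurrence time `R`. -/
def tailSum (ε : ℕ → ℝ) (n : ℕ) : ℝ := ∑ k ∈ Finset.range n, pt ε k

/-- Since `gap` is the difference sequence of `pt`, the renewal equation says that this convolution
grows by exactly `1` at each step. -/
lemma sum_pt_mul_renewalSum {ε : ℕ → ℝ} (h : IsPLSeq ε) (n : ℕ) :
    ∑ k ∈ Finset.range (n + 1), pt ε k * renewalSum ε (n - k) = n + 1 := by
  induction n with
  | zero => simp [renewalSum_zero, pt]
  | succ n ih =>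
    have e1 := renewalSum_eq h (n + 1)
    rw [Finset.sum_range_succ']
    simp only [Nat.add_sub_add_right, Nat.sub_zero, Nat.add_sub_cancel] at e1 ⊢
    have e2 : ∑ k ∈ Finset.range (n + 1), gap ε k * renewalSum ε (n - k) =
        ∑ k ∈ Finset.range (n + 1), pt ε k * renewalSum ε (n - k) -
        ∑ k ∈ Finset.range (n + 1), pt ε (k + 1) * renewalSum ε (n - k) := by
      rw [← Finset.sum_sub_distrib]
      exact Finset.sum_congr rfl fun k _ => by rw [gap]; ring
    have e3 : pt ε 0 = 1 := rfl
    rw [e3, e1, e2, ih]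
    push_cast
    ring

lemma le_tailSum_mul_renewalSum {ε : ℕ → ℝ} (h : IsPLSeq ε) (n : ℕ) :
    (n : ℝ) ≤ tailSum ε n * renewalSum ε n := by
  cases n with
  | zero => simp [tailSum]
  | succ n =>
    have := sum_pt_mul_renewalSum h n
    push_cast
    rw [← this, tailSum, Finset.sum_mul]
    exact Finset.sum_le_sum fun k _ => mul_le_mul_of_nonneg_left
      (renewalSum_mono h (by omega)) (h.pt_pos k).le

/-- Keep only the first `M` terms of the convolution at `n + M`; there `renewalSum` is still at
least its value at `n`. -/
lemma tailSum_mul_renewalSum_le {ε : ℕ → ℝ} (h : IsPLSeq ε) (M n : ℕ) :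
    tailSum ε M * renewalSum ε n ≤ n + M + 1 := by
  have := sum_pt_mul_renewalSum h (n + M)
  push_cast at this
  rw [← this, tailSum, Finset.sum_mul]
  refine (Finset.sum_le_sum fun k hk => ?_).trans (Finset.sum_le_sum_of_subset_of_nonneg
    (Finset.range_mono (by omega : M ≤ n + M + 1)) fun k _ _ => ?_)
  · have := Finset.mem_range.1 hk
    exact mul_le_mul_of_nonneg_left (renewalSum_mono h (by omega)) (h.pt_pos k).le
  · exact mul_nonneg (h.pt_pos k).le (zero_le_one.trans (one_le_renewalSum h _))

/-- The renewal sequence: the probability that there is a renewal at time `n`. -/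
def renewalMass (ε : ℕ → ℝ) : ℕ → ℝ
  | 0 => 1
  | n + 1 => renewalSum ε (n + 1) - renewalSum ε n

lemma renewalMass_nonneg {ε : ℕ → ℝ} (h : IsPLSeq ε) (n : ℕ) : 0 ≤ renewalMass ε n := by
  cases n with
  | zero => exact zero_le_one
  | succ n => exact sub_nonneg.2 (renewalSum_mono h (Nat.le_succ n))

lemma sum_renewalMass (ε : ℕ → ℝ) (n : ℕ) :
    ∑ k ∈ Finset.range (n + 1), renewalMass ε k = renewalSum ε n := by
  induction n with
  | zero => simp [renewalMass, renewalSum_zero]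
  | succ n ih => rw [Finset.sum_range_succ, ih, renewalMass]; ring

/-- Exactly one renewal is the last one up to time `n`: it happens at `n - k`, and the next
recurrence time exceeds `k`. The proof takes differences of `sum_pt_mul_renewalSum`. -/
lemma sum_pt_mul_renewalMass {ε : ℕ → ℝ} (h : IsPLSeq ε) (n : ℕ) :
    ∑ k ∈ Finset.range (n + 1), pt ε k * renewalMass ε (n - k) = 1 := by
  cases n with
  | zero => simp [renewalMass, pt]
  | succ n =>
    have e1 := sum_pt_mul_renewalSum h (n + 1)
    have e2 := sum_pt_mul_renewalSum h n
    rw [Finset.sum_range_succ] at e1 ⊢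
    have e3 : ∑ k ∈ Finset.range (n + 1), pt ε k * renewalMass ε (n + 1 - k) =
        ∑ k ∈ Finset.range (n + 1), pt ε k * renewalSum ε (n + 1 - k) -
        ∑ k ∈ Finset.range (n + 1), pt ε k * renewalSum ε (n - k) := by
      rw [← Finset.sum_sub_distrib]
      refine Finset.sum_congr rfl fun k hk => ?_
      have := Finset.mem_range.1 hk
      rw [show n + 1 - k = (n - k) + 1 by omega, renewalMass]
      ring
    rw [Nat.sub_self, renewalSum_zero] at e1
    rw [e3, Nat.sub_self, renewalMass, e2]
    push_cast at e1
    linarith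

lemma renewalMass_le_one {ε : ℕ → ℝ} (h : IsPLSeq ε) (n : ℕ) : renewalMass ε n ≤ 1 := by
  have := Finset.single_le_sum (f := fun k => pt ε k * renewalMass ε (n - k))
    (fun k _ => mul_nonneg (h.pt_pos k).le (renewalMass_nonneg h _))
    (Finset.mem_range.2 (Nat.succ_pos n))
  rw [sum_pt_mul_renewalMass h n] at this
  simpa [pt] using this

/-- In the last-renewal identity every weight `pt ε k` with `k ≤ n` is at least `pt ε n`. -/
lemma pt_mul_renewalSum_le_one {ε : ℕ → ℝ} (h : IsPLSeq ε) (n : ℕ) :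
    pt ε n * renewalSum ε n ≤ 1 := by
  rw [← sum_pt_mul_renewalMass h n, ← sum_renewalMass, Finset.mul_sum,
    ← Finset.sum_range_reflect (fun k => pt ε k * renewalMass ε (n - k))]
  refine Finset.sum_le_sum fun k hk => ?_
  have := Finset.mem_range.1 hk
  rw [show n - (n + 1 - 1 - k) = k by omega]
  exact mul_le_mul_of_nonneg_right (h.strictAnti_pt.antitone (by omega)) (renewalMass_nonneg h _)

/-- The tail formula `E[R] = ∑ P(R > k)`: write `k + 1` as the number of `j ≤ k` and exchange the
sums. -/
lemma meanRecurrenceTime_eq {ε : ℕ → ℝ} (h : IsPLSeq ε) :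
    meanRecurrenceTime ε = ∑' k, ENNReal.ofReal (pt ε k) := by
  have e1 : ∀ k : ℕ, ENNReal.ofReal (((k : ℝ) + 1) * (pt ε k - pt ε (k + 1))) =
      ∑' j, if j ≤ k then ENNReal.ofReal (gap ε k) else 0 := fun k => by
    rw [tsum_eq_sum (s := Finset.range (k + 1))]
    · rw [Finset.sum_congr rfl (g := fun _ => ENNReal.ofReal (gap ε k))]
      · rw [Finset.sum_const, Finset.card_range, nsmul_eq_mul, ← ENNReal.ofReal_natCast,
          ← ENNReal.ofReal_mul (by positivity)]
        push_cast
        rfl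
      · intro j hj
        rw [if_pos (Nat.lt_succ_iff.1 (Finset.mem_range.1 hj))]
    · intro j hj
      rw [if_neg fun h' => hj (Finset.mem_range.2 (Nat.lt_succ_of_le h'))]
  have e2 : ∀ j : ℕ, ∑' k, (if j ≤ k then ENNReal.ofReal (gap ε k) else 0) =
      ENNReal.ofReal (pt ε j) := fun j => by
    rw [← Summable.sum_add_tsum_nat_add' (k := j) ENNReal.summable, Finset.sum_eq_zero, zero_add]
    · simp only [Nat.le_add_left, if_true]
      have hs : HasSum (fun k => gap ε (k + j)) (pt ε j) := by
        rw [hasSum_iff_tendsto_nat_of_nonneg fun k => (h.gap_pos _).le]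
        have : ∀ n, ∑ k ∈ Finset.range n, gap ε (k + j) = pt ε j - pt ε (n + j) := fun n => by
          have := Finset.sum_range_sub' (fun k => pt ε (k + j)) n
          simp only [zero_add] at this
          rw [← this]
          exact Finset.sum_congr rfl fun k _ => by rw [gap, add_right_comm]
        simp only [this]
        simpa using ((tendsto_add_atTop_iff_nat j).2 h.tendsto_pt).const_sub (pt ε j)
      rw [← ENNReal.ofReal_tsum_of_nonneg (fun k => (h.gap_pos _).le) hs.summable, hs.tsum_eq]
    · intro k hk
      rw [if_neg (not_le.2 (Finset.mem_range.1 hk))]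
  rw [meanRecurrenceTime, tsum_congr e1, ENNReal.tsum_comm, tsum_congr e2]

lemma meanRecurrenceTime_lt_top_iff {ε : ℕ → ℝ} (h : IsPLSeq ε) :
    meanRecurrenceTime ε < ⊤ ↔ Summable (pt ε) := by
  rw [meanRecurrenceTime_eq h, lt_top_iff_ne_top]
  constructor
  · intro h'
    have := ENNReal.summable_toReal h'
    simpa [ENNReal.toReal_ofReal (h.pt_pos _).le] using this
  · exact fun hs => hs.tsum_ofReal_ne_top

lemma meanRecurrenceTime_toReal {ε : ℕ → ℝ} (h : IsPLSeq ε) (hs : Summable (pt ε)) :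
    (meanRecurrenceTime ε).toReal = ∑' k, pt ε k := by
  rw [meanRecurrenceTime_eq h, ← ENNReal.ofReal_tsum_of_nonneg (fun k => (h.pt_pos _).le) hs,
    ENNReal.toReal_ofReal (tsum_nonneg fun k => (h.pt_pos _).le)]

/-! ### The elementary renewal theorem. -/

lemma tailSum_pos {ε : ℕ → ℝ} (h : IsPLSeq ε) {n : ℕ} (hn : n ≠ 0) : 0 < tailSum ε n :=
  Finset.sum_pos (fun k _ => h.pt_pos k) (Finset.nonempty_range_iff.2 hn)

/-- Cesàro averaging of `pt → 0` gives `T_n / n → 0`, and `U_n ≥ n / T_n`. -/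
lemma tendsto_renewalSum {ε : ℕ → ℝ} (h : IsPLSeq ε) :
    Tendsto (renewalSum ε) atTop atTop := by
  have h1 : Tendsto (fun n : ℕ => (n : ℝ)⁻¹ * tailSum ε n) atTop (𝓝[>] 0) := by
    refine tendsto_nhdsWithin_iff.2 ⟨h.tendsto_pt.cesaro, ?_⟩
    filter_upwards [eventually_ne_atTop 0] with n hn
    exact mul_pos (by positivity) (tailSum_pos h hn)
  refine tendsto_atTop_mono' _ ?_ h1.inv_tendsto_nhdsGT_zero
  filter_upwards [eventually_ne_atTop 0] with n hn
  have hT := tailSum_pos h hn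
  simp only [Pi.inv_apply, mul_inv, inv_inv]
  rw [← div_eq_mul_inv, div_le_iff₀ hT, mul_comm]
  exact le_tailSum_mul_renewalSum h n

lemma tendsto_meanPassages {ε : ℕ → ℝ} (h : IsPLSeq ε) :
    Tendsto (meanPassages ε) atTop atTop := by
  have := tendsto_atTop_add_const_right _ (-1 : ℝ) (tendsto_renewalSum h)
  refine this.congr fun n => ?_
  rw [renewalSum]; ring

/-- The elementary renewal theorem, for finite and infinite mean at once. -/
lemma tendsto_renewalSum_div {ε : ℕ → ℝ} (h : IsPLSeq ε) {τ : ℝ}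
    (hτ : Tendsto (fun n => (tailSum ε n)⁻¹) atTop (𝓝 τ)) (hle : ∀ n, τ * tailSum ε n ≤ 1) :
    Tendsto (fun n : ℕ => renewalSum ε n / n) atTop (𝓝 τ) := by
  refine tendsto_order.2 ⟨fun a ha => ?_, fun a ha => ?_⟩
  · filter_upwards [eventually_ne_atTop 0] with n hn
    have hn' : (0 : ℝ) < n := by positivity
    refine ha.trans_le ?_
    rw [le_div_iff₀ hn']
    by_cases hτ0 : τ ≤ 0
    · exact (mul_nonpos_of_nonpos_of_nonneg hτ0 hn'.le).trans
        (zero_le_one.trans (one_le_renewalSum h n))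
    calc τ * n ≤ τ * (tailSum ε n * renewalSum ε n) :=
          mul_le_mul_of_nonneg_left (le_tailSum_mul_renewalSum h n) (not_le.1 hτ0).le
      _ = τ * tailSum ε n * renewalSum ε n := by ring
      _ ≤ renewalSum ε n :=
          mul_le_of_le_one_left (zero_le_one.trans (one_le_renewalSum h n)) (hle n)
  -- With `M` fixed so that `1 / T_M < a`, the bound `U_n / n ≤ (1 + (M + 1) / n) / T_M` is
  -- eventually below `a`.
  · obtain ⟨M, hM, hM0⟩ := ((hτ.eventually (gt_mem_nhds ha)).and (eventually_ne_atTop 0)).exists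
    have hT := tailSum_pos h hM0
    have hlim : Tendsto (fun n : ℕ => (tailSum ε M)⁻¹ * (1 + (M + 1) / (n : ℝ))) atTop
        (𝓝 ((tailSum ε M)⁻¹ * (1 + 0))) :=
      ((tendsto_const_div_atTop_nhds_zero_nat _).const_add _).const_mul _
    rw [add_zero, mul_one] at hlim
    filter_upwards [hlim.eventually (gt_mem_nhds hM), eventually_ne_atTop 0] with n hn hn0
    have hn' : (0 : ℝ) < n := by positivity
    refine lt_of_le_of_lt ?_ hn
    have := tailSum_mul_renewalSum_le h M n
    rw [div_le_iff₀ hn']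
    have e : (tailSum ε M)⁻¹ * (1 + (M + 1) / (n : ℝ)) * n =
        (tailSum ε M)⁻¹ * (n + M + 1) := by
      field_simp
      ring
    rw [e, inv_mul_eq_div, le_div_iff₀ hT, mul_comm]
    exact this

lemma meanPassages_isEquivalent_renewalSum {ε : ℕ → ℝ} (h : IsPLSeq ε) :
    meanPassages ε ~[atTop] renewalSum ε := by
  have : (fun _ : ℕ => (-1 : ℝ)) =o[atTop] renewalSum ε :=
    isLittleO_const_left.2 (Or.inr (tendsto_norm_atTop_atTop.comp (tendsto_renewalSum h)))
  refine (IsEquivalent.refl.add_isLittleO this).congr_left (Eventually.of_forall fun n => ?_)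
  simp [renewalSum]

lemma meanPassages_isEquivalent_of_summable {ε : ℕ → ℝ} (h : IsPLSeq ε) (hs : Summable (pt ε)) :
    meanPassages ε ~[atTop] fun n : ℕ => (n : ℝ) / (meanRecurrenceTime ε).toReal := by
  rw [meanRecurrenceTime_toReal h hs]
  have hpos : 0 < ∑' k, pt ε k := hs.tsum_pos (fun k => (h.pt_pos k).le) 0 (h.pt_pos 0)
  have hlim := tendsto_renewalSum_div h (hs.hasSum.tendsto_sum_nat.inv₀ hpos.ne') fun n => by
    rw [inv_mul_le_one₀ hpos]
    exact hs.sum_le_tsum _ fun k _ => (h.pt_pos k).le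
  refine (meanPassages_isEquivalent_renewalSum h).trans ?_
  refine (isEquivalent_iff_tendsto_one ?_).2 ?_
  · filter_upwards [eventually_ne_atTop 0] with n hn
    positivity
  · have := hlim.mul_const (∑' k, pt ε k)
    rw [inv_mul_cancel₀ hpos.ne'] at this
    refine this.congr fun n => ?_
    simp only [Pi.div_apply]
    rw [div_div_eq_mul_div, div_mul_eq_mul_div]

lemma meanPassages_isLittleO {ε : ℕ → ℝ} (h : IsPLSeq ε) (hs : ¬ Summable (pt ε)) :
    meanPassages ε =o[atTop] fun n : ℕ => (n : ℝ) := by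
  have h1 : Tendsto (tailSum ε) atTop atTop :=
    (not_summable_iff_tendsto_nat_atTop_of_nonneg fun k => (h.pt_pos k).le).1 hs
  have hlim := tendsto_renewalSum_div h h1.inv_tendsto_atTop fun n => by simp
  refine (meanPassages_isEquivalent_renewalSum h).isBigO.trans_isLittleO ?_
  refine (isLittleO_iff_tendsto' ?_).2 hlim
  filter_upwards [eventually_ne_atTop 0] with n hn h0
  exact absurd (Nat.cast_eq_zero.1 h0) hn

/-! ### The lower tail of the number of visits. -/

/-- The left side is `E[min(S_j, M)]`. By induction on `j`, one more recurrence adds at most `T_M`,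
because the convolution with `gap` has total mass at most `1`. -/
lemma sum_visitsCDF_le {ε : ℕ → ℝ} (h : IsPLSeq ε) (j M : ℕ) :
    ∑ n ∈ Finset.range M, visitsCDF ε j n ≤ j * tailSum ε M := by
  induction j with
  | zero => simp [visitsCDF_zero]
  | succ j ih =>
    have key : ∑ n ∈ Finset.range M, ∑ k ∈ Finset.range n, gap ε k * visitsCDF ε j (n - 1 - k) ≤
        ∑ n ∈ Finset.range M, visitsCDF ε j n := by
      cases M with
      | zero => simp
      | succ M =>
        rw [Finset.sum_range_succ']
        simp only [Nat.add_sub_cancel, Finset.range_zero, Finset.sum_empty, add_zero]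
        rw [Finset.sum_range_diag_flip M (fun k i => gap ε k * visitsCDF ε j i)]
        calc _ ≤ ∑ k ∈ Finset.range M, gap ε k * ∑ n ∈ Finset.range (M + 1), visitsCDF ε j n := by
              refine Finset.sum_le_sum fun k _ => ?_
              rw [← Finset.mul_sum]
              refine mul_le_mul_of_nonneg_left ?_ (h.gap_pos k).le
              exact Finset.sum_le_sum_of_subset_of_nonneg (Finset.range_mono (by omega))
                fun i _ _ => visitsCDF_nonneg ε j i
          _ ≤ _ := by
              rw [← Finset.sum_mul, sum_gap]
              refine mul_le_of_le_one_left (Finset.sum_nonneg fun i _ => visitsCDF_nonneg ε j i) ?_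
              linarith [h.pt_pos M]
    simp only [visitsCDF_succ h, Finset.sum_add_distrib]
    push_cast
    rw [add_mul, one_mul, add_comm]
    exact add_le_add (key.trans ih) le_rfl

/-- Monotonicity in `n` turns the averaged bound into a pointwise one. The constant comes from `T_n
U_n ≤ 2n + 1 ≤ 3n`. -/
lemma visitsCDF_le {ε : ℕ → ℝ} (h : IsPLSeq ε) (j : ℕ) {n : ℕ} (hn : n ≠ 0) :
    visitsCDF ε j n ≤ 3 * j / renewalSum ε n := by
  have hn' : (0 : ℝ) < n := by positivity
  have hU : 0 < renewalSum ε n := one_pos.trans_le (one_le_renewalSum h n)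
  have h1 : n * visitsCDF ε j n ≤ j * tailSum ε n := by
    refine le_trans ?_ (sum_visitsCDF_le h j n)
    have := Finset.card_nsmul_le_sum (Finset.range n) (visitsCDF ε j) (visitsCDF ε j n)
      fun k hk => visitsCDF_antitone h j (Finset.mem_range.1 hk).le
    simpa using this
  have h2 := tailSum_mul_renewalSum_le h n n
  have h3 : (1 : ℝ) ≤ n := by exact_mod_cast Nat.one_le_iff_ne_zero.2 hn
  rw [le_div_iff₀ hU]
  refine le_of_mul_le_mul_left ?_ hn'
  calc n * (visitsCDF ε j n * renewalSum ε n) = n * visitsCDF ε j n * renewalSum ε n := by ring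
    _ ≤ j * tailSum ε n * renewalSum ε n := mul_le_mul_of_nonneg_right h1 hU.le
    _ = j * (tailSum ε n * renewalSum ε n) := by ring
    _ ≤ j * (3 * n) := mul_le_mul_of_nonneg_left (by linarith) (by positivity)
    _ = n * (3 * j) := by ring

lemma tendsto_leb_visits_le {ε : ℕ → ℝ} (h : IsPLSeq ε) {b : ℕ → ℝ}
    (hb : b =o[atTop] meanPassages ε) :
    Tendsto (fun n => leb {x | (visits ε n x : ℝ) ≤ b n}) atTop (𝓝 0) := by
  have hU := tendsto_renewalSum h
  have h1 : Tendsto (fun n => 3 * (|b n| / renewalSum ε n + (renewalSum ε n)⁻¹)) atTop (𝓝 0) := by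
    have h2 : b =o[atTop] renewalSum ε :=
      hb.trans_isBigO (meanPassages_isEquivalent_renewalSum h).isBigO
    have := ((h2.abs_left.tendsto_div_nhds_zero).add hU.inv_tendsto_atTop).const_mul (3 : ℝ)
    simpa using this
  have h2 := ENNReal.tendsto_ofReal h1
  rw [ENNReal.ofReal_zero] at h2
  refine tendsto_of_tendsto_of_tendsto_of_le_of_le' tendsto_const_nhds h2
    (Eventually.of_forall fun _ => zero_le) ?_
  filter_upwards [eventually_ne_atTop 0] with n hn
  -- The absolute value allows for negative `b n`; the `+ 1` makes the inequality strict, as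
  -- `visitsCDF` requires.
  have hsub : {x | (visits ε n x : ℝ) ≤ b n} ⊆ {x | visits ε n x < ⌊|b n|⌋₊ + 1} := fun x hx =>
    Nat.lt_succ_of_le (Nat.le_floor (le_trans hx (le_abs_self _)))
  refine (measure_mono hsub).trans ?_
  rw [leb_setOf_visits_lt h]
  refine ENNReal.ofReal_le_ofReal ((visitsCDF_le h _ hn).trans ?_)
  have hU : 0 < renewalSum ε n := one_pos.trans_le (one_le_renewalSum h n)
  rw [← one_div, ← add_div, ← mul_div_assoc]
  refine div_le_div_of_nonneg_right ?_ hU.le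
  have := Nat.floor_le (abs_nonneg (b n))
  push_cast
  linarith

/-! ### Logarithmic tails. -/

lemma one_sub_recurrenceCDF (ε : ℕ → ℝ) (x : ℝ) : 1 - recurrenceCDF ε x = pt ε ⌊x⌋₊ := by
  have e : recurrenceCDF ε x = ∑ k ∈ Finset.range ⌊x⌋₊, gap ε k := by
    rw [recurrenceCDF, ← Finset.Ico_add_one_right_eq_Icc, Finset.sum_Ico_eq_sum_range]
    refine Finset.sum_congr (by simp) fun k _ => ?_
    rw [gap, Nat.add_sub_cancel_left, add_comm]
  rw [e, sum_gap]; ring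

lemma tailSum_le {ε : ℕ → ℝ} (h : IsPLSeq ε) (m n : ℕ) :
    tailSum ε n ≤ m + n * pt ε m := by
  have : tailSum ε n ≤ ∑ k ∈ Finset.range n, ((if k < m then 1 else 0) + pt ε m) := by
    refine Finset.sum_le_sum fun k _ => ?_
    split_ifs with hk
    · linarith [h.pt_le_one k, h.pt_pos m]
    · rw [zero_add]; exact h.strictAnti_pt.antitone (not_lt.1 hk)
  refine this.trans ?_
  rw [Finset.sum_add_distrib, Finset.sum_const, Finset.card_range, nsmul_eq_mul]
  refine add_le_add ?_ le_rfl
  rw [← Finset.sum_filter, Finset.sum_const, nsmul_eq_mul, mul_one]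
  have : (Finset.range n).filter (· < m) ⊆ Finset.range m := fun k hk => by
    simpa using (Finset.mem_filter.1 hk).2
  exact_mod_cast (Finset.card_le_card this).trans (Finset.card_range m).le

/-- The upper bound is `pt n * U_n ≤ 1`. For the lower one, `T_n` is split at `n ^ θ` with `θ < 1`:
the first part is negligible against `n / log n`, and the logarithm at `n ^ θ` loses only a factor
`θ`, which may be taken close to `1`. -/
lemma meanPassages_isEquivalent_log {ε : ℕ → ℝ} (h : IsPLSeq ε)
    (hl : Tendsto (fun x : ℝ => pt ε ⌊x⌋₊ * Real.log x) atTop (𝓝 1)) :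
    meanPassages ε ~[atTop] fun n : ℕ => Real.log n := by
  refine (meanPassages_isEquivalent_renewalSum h).trans ?_
  have hlog : ∀ᶠ n : ℕ in atTop, 0 < Real.log n := by
    filter_upwards [eventually_gt_atTop 1] with n hn
    exact Real.log_pos (by exact_mod_cast hn)
  refine (isEquivalent_iff_tendsto_one (hlog.mono fun n hn => hn.ne')).2 ?_
  have hln : Tendsto (fun n : ℕ => pt ε n * Real.log n) atTop (𝓝 1) := by
    have := hl.comp tendsto_natCast_atTop_atTop
    simpa [Function.comp_def] using this
  refine tendsto_order.2 ⟨fun a ha => ?_, fun a ha => ?_⟩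
  · obtain ⟨θ, hθ, hθ1⟩ := exists_between (max_lt ha one_pos)
    have hθ0 : 0 < θ := (le_max_right _ _).trans_lt hθ
    have haθ : a < θ := (le_max_left _ _).trans_lt hθ
    have h1 : Tendsto (fun n : ℕ => pt ε ⌊(n : ℝ) ^ θ⌋₊ * Real.log n) atTop (𝓝 θ⁻¹) := by
      have := (hl.comp ((tendsto_rpow_atTop hθ0).comp tendsto_natCast_atTop_atTop)).const_mul θ⁻¹
      rw [mul_one] at this
      refine this.congr' ?_
      filter_upwards [eventually_ne_atTop 0] with n hn
      simp only [Function.comp_apply]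
      rw [Real.log_rpow (by positivity)]
      field_simp
    have h2 : Tendsto (fun n : ℕ => Real.log n / (n : ℝ) ^ (1 - θ)) atTop (𝓝 0) :=
      ((isLittleO_log_rpow_atTop (sub_pos.2 hθ1)).tendsto_div_nhds_zero).comp
        tendsto_natCast_atTop_atTop
    have h3 := (h2.add h1).inv₀ (by positivity)
    rw [zero_add, inv_inv] at h3
    filter_upwards [h3.eventually (lt_mem_nhds haθ), hlog, eventually_ne_atTop 0] with n hn hn1 hn0
    refine hn.trans_le ?_
    have hn' : (0 : ℝ) < n := by positivity
    have hT := tailSum_pos h hn0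
    have b1 := le_tailSum_mul_renewalSum h n
    have b2 := tailSum_le h ⌊(n : ℝ) ^ θ⌋₊ n
    have b3 : (⌊(n : ℝ) ^ θ⌋₊ : ℝ) ≤ (n : ℝ) ^ θ := Nat.floor_le (by positivity)
    have b4 : (n : ℝ) ^ θ = n / (n : ℝ) ^ (1 - θ) := by
      rw [Real.rpow_sub hn', Real.rpow_one]
      field_simp
    have b5 : tailSum ε n * Real.log n ≤ n * (Real.log n / (n : ℝ) ^ (1 - θ) +
        pt ε ⌊(n : ℝ) ^ θ⌋₊ * Real.log n) := by
      calc tailSum ε n * Real.log n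
          ≤ (n / (n : ℝ) ^ (1 - θ) + n * pt ε ⌊(n : ℝ) ^ θ⌋₊) * Real.log n :=
            mul_le_mul_of_nonneg_right (by linarith) hn1.le
        _ = _ := by ring
    simp only [Pi.div_apply]
    have hD : 0 < Real.log n / (n : ℝ) ^ (1 - θ) + pt ε ⌊(n : ℝ) ^ θ⌋₊ * Real.log n := by
      have := h.pt_pos ⌊(n : ℝ) ^ θ⌋₊
      positivity
    calc _ ≤ n / (tailSum ε n * Real.log n) := by
          rw [inv_eq_one_div, div_le_div_iff₀ hD (by positivity), one_mul]
          exact b5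
      _ ≤ tailSum ε n * renewalSum ε n / (tailSum ε n * Real.log n) := by gcongr
      _ = _ := mul_div_mul_left _ _ hT.ne'
  · have := hln.inv₀ one_ne_zero
    rw [inv_one] at this
    filter_upwards [this.eventually (gt_mem_nhds ha), hlog] with n hn hn1
    refine lt_of_le_of_lt ?_ hn
    have hp := h.pt_pos n
    simp only [Pi.div_apply]
    rw [mul_inv, ← div_eq_mul_inv]
    gcongr
    rw [← one_div, le_div_iff₀ hp, mul_comm]
    exact pt_mul_renewalSum_le_one h n

/-! ### The method of moments on the unit interval. -/

section Moments

variable {μ : ℕ → Measure ℝ} {ν : Measure ℝ}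

lemma integrable_of_continuous_of_ae_mem_Icc {m : Measure ℝ} [IsFiniteMeasure m]
    (hm : ∀ᵐ x ∂m, x ∈ Set.Icc (0 : ℝ) 1) {h : ℝ → ℝ} (hh : Continuous h) : Integrable h m := by
  obtain ⟨C, hC⟩ := isCompact_Icc.exists_bound_of_continuousOn (hh.continuousOn (s := Set.Icc 0 1))
  exact Integrable.of_bound hh.aestronglyMeasurable C (hm.mono hC)

/-- On the unit interval, convergence of all moments implies weak convergence. -/
lemma tendsto_integral_of_tendsto_moments [∀ n, IsFiniteMeasure (μ n)] [IsFiniteMeasure ν]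
    (hμ : ∀ n, ∀ᵐ x ∂μ n, x ∈ Set.Icc (0 : ℝ) 1) (hν : ∀ᵐ x ∂ν, x ∈ Set.Icc (0 : ℝ) 1)
    (hmom : ∀ k : ℕ, Tendsto (fun n => ∫ x, x ^ k ∂μ n) atTop (𝓝 (∫ x, x ^ k ∂ν)))
    {h : ℝ → ℝ} (hh : Continuous h) :
    Tendsto (fun n => ∫ x, h x ∂μ n) atTop (𝓝 (∫ x, h x ∂ν)) := by
  have hpoly : ∀ p : Polynomial ℝ,
      Tendsto (fun n => ∫ x, p.eval x ∂μ n) atTop (𝓝 (∫ x, p.eval x ∂ν)) := by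
    intro p
    induction p using Polynomial.induction_on' with
    | add p q hp hq =>
      simp only [Polynomial.eval_add]
      rw [integral_add (integrable_of_continuous_of_ae_mem_Icc hν p.continuous)
        (integrable_of_continuous_of_ae_mem_Icc hν q.continuous)]
      refine (hp.add hq).congr fun n => ?_
      rw [integral_add (integrable_of_continuous_of_ae_mem_Icc (hμ n) p.continuous)
        (integrable_of_continuous_of_ae_mem_Icc (hμ n) q.continuous)]
    | monomial k a =>
      simp only [Polynomial.eval_monomial, integral_const_mul]
      exact (hmom k).const_mul a
  have hmass : Tendsto (fun n => (μ n).real Set.univ) atTop (𝓝 (ν.real Set.univ)) := by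
    simpa using hmom 0
  rw [Metric.tendsto_atTop']
  intro δ hδ
  -- Eventually `K` bounds all the masses, so a polynomial within `δ / (4 * K)` costs at most `δ /
  -- 4` under each measure; the three errors add up to less than `δ`.
  set K := ν.real Set.univ + 1 with hK
  have hKpos : 0 < K := by positivity
  obtain ⟨p, hp⟩ := exists_polynomial_near_of_continuousOn 0 1 h hh.continuousOn (δ / (4 * K))
    (by positivity)
  have hbound : ∀ m : Measure ℝ, IsFiniteMeasure m → (∀ᵐ x ∂m, x ∈ Set.Icc (0 : ℝ) 1) →
      m.real Set.univ ≤ K → |∫ x, p.eval x ∂m - ∫ x, h x ∂m| ≤ δ / 4 := by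
    intro m _ hm hmK
    rw [← integral_sub (integrable_of_continuous_of_ae_mem_Icc hm p.continuous)
        (integrable_of_continuous_of_ae_mem_Icc hm hh), ← Real.norm_eq_abs]
    refine (norm_integral_le_of_norm_le_const (C := δ / (4 * K))
      (hm.mono fun x hx => (hp x hx).le)).trans ?_
    calc δ / (4 * K) * m.real Set.univ ≤ δ / (4 * K) * K := by gcongr
      _ = δ / 4 := by field_simp
  have e1 := hbound ν inferInstance hν (by rw [hK]; linarith)
  have hev := (hmass.eventually (gt_mem_nhds (lt_add_one _))).and
    ((hpoly p).eventually (Metric.ball_mem_nhds _ (by positivity : 0 < δ / 4)))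
  obtain ⟨N, hN⟩ := eventually_atTop.1 hev
  refine ⟨N, fun n hn => ?_⟩
  obtain ⟨h1, h2⟩ := hN n hn.le
  have e2 := hbound (μ n) inferInstance (hμ n) h1.le
  rw [Real.dist_eq] at h2 ⊢
  rw [abs_le] at e1 e2
  rw [abs_lt] at h2 ⊢
  constructor <;> linarith

/-- The test function of Karamata's method: `x⁻¹` cut off below `exp (-θ)`. -/
def cutoffInv (θ x : ℝ) : ℝ := if Real.exp (-θ) ≤ x then x⁻¹ else 0

lemma cutoffInv_nonneg (θ x : ℝ) : 0 ≤ cutoffInv θ x := by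
  unfold cutoffInv
  split_ifs with h
  · exact inv_nonneg.2 ((Real.exp_pos _).le.trans h)
  · exact le_rfl

lemma cutoffInv_le (θ x : ℝ) : cutoffInv θ x ≤ Real.exp θ := by
  unfold cutoffInv
  split_ifs with h
  · rw [← neg_neg θ, Real.exp_neg (-θ)]
    exact inv_anti₀ (Real.exp_pos _) h
  · exact (Real.exp_pos _).le

lemma measurable_cutoffInv (θ : ℝ) : Measurable (cutoffInv θ) :=
  Measurable.ite measurableSet_Ici measurable_inv measurable_const

lemma integrable_cutoffInv (m : Measure ℝ) [IsFiniteMeasure m] (θ : ℝ) :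
    Integrable (cutoffInv θ) m :=
  Integrable.of_bound (measurable_cutoffInv θ).aestronglyMeasurable (Real.exp θ)
    (Eventually.of_forall fun x => by
      rw [Real.norm_eq_abs, abs_of_nonneg (cutoffInv_nonneg θ x)]; exact cutoffInv_le θ x)

/-- A continuous function lies between two cut-off inverses. -/
lemma exists_continuous_between_cutoffInv {θ θ' : ℝ} (hθ : θ < θ') :
    ∃ h : ℝ → ℝ, Continuous h ∧ (∀ x, cutoffInv θ x ≤ h x) ∧ ∀ x, h x ≤ cutoffInv θ' x := by
  set a := Real.exp (-θ') with ha
  set b := Real.exp (-θ) with hb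
  have ha0 : 0 < a := Real.exp_pos _
  have hab : a < b := Real.exp_lt_exp.2 (by linarith)
  have hba : 0 < b - a := sub_pos.2 hab
  have hmax : ∀ x, 0 < max x a := fun x => ha0.trans_le (le_max_right _ _)
  -- A linear ramp from `0` at `a` to `1` at `b`, divided by `x`; `max x a` keeps the denominator
  -- positive.
  refine ⟨fun x => max 0 (min 1 ((x - a) / (b - a))) / max x a, ?_, fun x => ?_, fun x => ?_⟩
  · refine Continuous.div ?_ ?_ fun x => (hmax x).ne'
    · exact continuous_const.max (continuous_const.min ((continuous_id.sub continuous_const).div_const _))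
    · exact continuous_id.max continuous_const
  · simp only [cutoffInv]
    split_ifs with hx
    · have h1 : 1 ≤ (x - a) / (b - a) := (one_le_div hba).2 (by linarith)
      rw [min_eq_left h1, max_eq_right zero_le_one, max_eq_left (hab.le.trans hx), one_div]
    · exact div_nonneg (le_max_left _ _) (hmax x).le
  · unfold cutoffInv
    split_ifs with hx
    · have hx' : max x a = x := max_eq_left hx
      simp only [hx', ← one_div]
      exact div_le_div_of_nonneg_right (max_le zero_le_one (min_le_left _ _)) (ha0.le.trans hx)
    · have h1 : (x - a) / (b - a) ≤ 0 := div_nonpos_of_nonpos_of_nonneg (by linarith) hba.le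
      simp only
      rw [max_eq_left ((min_le_right _ _).trans h1), zero_div]

/-- The cut-off function jumps, so it is squeezed between continuous functions using a nearby
threshold `t`. Continuity of the limit integral in the threshold closes the gap. -/
lemma tendsto_integral_cutoffInv [∀ n, IsFiniteMeasure (μ n)] [IsFiniteMeasure ν]
    (hμ : ∀ n, ∀ᵐ x ∂μ n, x ∈ Set.Icc (0 : ℝ) 1) (hν : ∀ᵐ x ∂ν, x ∈ Set.Icc (0 : ℝ) 1)
    (hmom : ∀ k : ℕ, Tendsto (fun n => ∫ x, x ^ k ∂μ n) atTop (𝓝 (∫ x, x ^ k ∂ν)))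
    {θ : ℝ} (hc : ContinuousAt (fun t => ∫ x, cutoffInv t x ∂ν) θ) :
    Tendsto (fun n => ∫ x, cutoffInv θ x ∂μ n) atTop (𝓝 (∫ x, cutoffInv θ x ∂ν)) := by
  refine tendsto_order.2 ⟨fun a ha => ?_, fun a ha => ?_⟩
  · obtain ⟨t, hta, htθ⟩ : ∃ t, a < ∫ x, cutoffInv t x ∂ν ∧ t < θ :=
      (((hc.tendsto.eventually (lt_mem_nhds ha)).filter_mono nhdsWithin_le_nhds).and
        (self_mem_nhdsWithin (a := θ) (s := Set.Iio θ))).exists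
    obtain ⟨h, hcont, h1, h2⟩ := exists_continuous_between_cutoffInv htθ
    have hlim := tendsto_integral_of_tendsto_moments hμ hν hmom hcont
    have : a < ∫ x, h x ∂ν := hta.trans_le (integral_mono (integrable_cutoffInv ν t)
      (integrable_of_continuous_of_ae_mem_Icc hν hcont) h1)
    filter_upwards [hlim.eventually (lt_mem_nhds this)] with n hn
    exact hn.trans_le (integral_mono (integrable_of_continuous_of_ae_mem_Icc (hμ n) hcont)
      (integrable_cutoffInv (μ n) θ) h2)
  · obtain ⟨t, hta, htθ⟩ : ∃ t, ∫ x, cutoffInv t x ∂ν < a ∧ θ < t :=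
      (((hc.tendsto.eventually (gt_mem_nhds ha)).filter_mono nhdsWithin_le_nhds).and
        (self_mem_nhdsWithin (a := θ) (s := Set.Ioi θ))).exists
    obtain ⟨h, hcont, h1, h2⟩ := exists_continuous_between_cutoffInv htθ
    have hlim := tendsto_integral_of_tendsto_moments hμ hν hmom hcont
    have : ∫ x, h x ∂ν < a := (integral_mono (integrable_of_continuous_of_ae_mem_Icc hν hcont)
      (integrable_cutoffInv ν t) h2).trans_lt hta
    filter_upwards [hlim.eventually (gt_mem_nhds this)] with n hn
    exact (integral_mono (integrable_cutoffInv (μ n) θ)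
      (integrable_of_continuous_of_ae_mem_Icc (hμ n) hcont) h1).trans_lt hn

end Moments

/-! ### Integrals against the Gamma law, the limit law in Karamata's theorem. -/

section Gamma

open ProbabilityTheory

lemma integral_gammaMeasure_one {a : ℝ} (ha : 0 < a) (f : ℝ → ℝ) :
    ∫ t, f t ∂gammaMeasure a 1 =
      (Real.Gamma a)⁻¹ * ∫ t in Set.Ioi 0, t ^ (a - 1) * Real.exp (-t) * f t := by
  have hm : Measurable (gammaPDF a 1) := (measurable_gammaPDFReal a 1).ennreal_ofReal
  rw [gammaMeasure, integral_withDensity_eq_integral_toReal_smul hm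
    (Eventually.of_forall fun x => ENNReal.ofReal_lt_top), ← integral_const_mul,
    ← integral_Ici_eq_integral_Ioi, ← integral_indicator measurableSet_Ici]
  refine integral_congr_ae (Eventually.of_forall fun t => ?_)
  by_cases ht : 0 ≤ t
  · simp only [gammaPDF]
    rw [ENNReal.toReal_ofReal (gammaPDFReal_nonneg ha one_pos t),
      Set.indicator_of_mem (Set.mem_Ici.2 ht), gammaPDFReal, if_pos ht, Real.one_rpow, one_mul,
      smul_eq_mul]
    ring
  · simp only []
    rw [gammaPDF_of_neg (not_le.1 ht), Set.indicator_of_notMem (by simpa using ht)]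
    simp

lemma ae_nonneg_gammaMeasure (a r : ℝ) : ∀ᵐ t ∂gammaMeasure a r, 0 ≤ t := by
  have hm : Measurable (gammaPDF a r) := (measurable_gammaPDFReal a r).ennreal_ofReal
  rw [gammaMeasure, ae_withDensity_iff hm]
  refine Eventually.of_forall fun t ht => ?_
  by_contra h
  exact ht (gammaPDF_of_neg (not_le.1 h))

lemma integral_exp_neg_pow_gammaMeasure {a : ℝ} (ha : 0 < a) (k : ℕ) :
    ∫ t, Real.exp (-t) ^ k ∂gammaMeasure a 1 = ((k : ℝ) + 1) ^ (-a) := by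
  have hk : (0 : ℝ) < k + 1 := by positivity
  rw [integral_gammaMeasure_one ha]
  have : ∀ t : ℝ, t ^ (a - 1) * Real.exp (-t) * Real.exp (-t) ^ k =
      t ^ (a - 1) * Real.exp (-((k + 1) * t)) := fun t => by
    rw [← Real.exp_nat_mul, mul_assoc, ← Real.exp_add]
    congr 2
    ring
  simp only [this]
  rw [Real.integral_rpow_mul_exp_neg_mul_Ioi ha hk, one_div, Real.inv_rpow hk.le,
    Real.rpow_neg hk.le]
  have := (Real.Gamma_pos_of_pos ha).ne'
  field_simp

/-- The cut-off inverse of `e^{-t}` is `e^t` on `[0, θ]`, which cancels the exponential in the Gamma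
density and leaves a power. -/
lemma integral_cutoffInv_exp_neg_gammaMeasure {a : ℝ} (ha : 0 < a) {θ : ℝ} (hθ : 0 ≤ θ) :
    ∫ t, cutoffInv θ (Real.exp (-t)) ∂gammaMeasure a 1 = θ ^ a / Real.Gamma (a + 1) := by
  rw [integral_gammaMeasure_one ha]
  have e : ∫ t in Set.Ioi 0, t ^ (a - 1) * Real.exp (-t) * cutoffInv θ (Real.exp (-t)) =
      ∫ t in (0 : ℝ)..θ, t ^ (a - 1) := by
    rw [intervalIntegral.integral_of_le hθ, ← integral_indicator measurableSet_Ioi,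
      ← integral_indicator measurableSet_Ioc]
    congr 1 with t
    simp only [Set.indicator_apply, Set.mem_Ioi, Set.mem_Ioc, cutoffInv, Real.exp_le_exp,
      neg_le_neg_iff]
    by_cases h0 : 0 < t <;> by_cases h1 : t ≤ θ <;> simp [h0, h1, (Real.exp_pos _).ne']
  rw [e, integral_rpow (Or.inl (by linarith)), sub_add_cancel, Real.zero_rpow ha.ne', sub_zero,
    Real.Gamma_add_one ha.ne']
  have := (Real.Gamma_pos_of_pos ha).ne'
  field_simp

end Gamma

/-! ### Tauberian and Abelian theorems. -/

/-- Karamata's Tauberian theorem for power series with nonnegative coefficients. -/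
theorem tendsto_sum_div_rpow_of_tendsto_laplace {u : ℕ → ℝ} (hu : ∀ n, 0 ≤ u n)
    (hs : ∀ r : ℝ, 0 < r → Summable fun m : ℕ => u m * Real.exp (-(r * m))) {α c : ℝ} (hα : 0 < α)
    (hlim : Tendsto (fun r : ℝ => r ^ α * ∑' m : ℕ, u m * Real.exp (-(r * m))) (𝓝[>] 0) (𝓝 c)) :
    Tendsto (fun n : ℕ => (∑ m ∈ Finset.range (n + 1), u m) / (n : ℝ) ^ α) atTop
      (𝓝 (c / Real.Gamma (α + 1))) := by
  have hc : 0 ≤ c := ge_of_tendsto hlim <| by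
    filter_upwards [self_mem_nhdsWithin] with r hr
    exact mul_nonneg (Real.rpow_nonneg (le_of_lt hr) _)
      (tsum_nonneg fun m => mul_nonneg (hu m) (Real.exp_pos _).le)
  set r : ℕ → ℝ := fun n => 1 / ((n : ℝ) + 1) with hr
  have hr0 : ∀ n, 0 < r n := fun n => by simp only [hr]; positivity
  have hrlim : Tendsto r atTop (𝓝 0) := tendsto_one_div_add_atTop_nhds_zero_nat
  set w : ℕ → ℕ → ℝ := fun n m => r n ^ α * (u m * Real.exp (-(r n * m))) with hw
  have hw0 : ∀ n m, 0 ≤ w n m := fun n m => mul_nonneg (Real.rpow_nonneg (hr0 n).le _)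
    (mul_nonneg (hu m) (Real.exp_pos _).le)
  -- With `r = 1 / (n + 1)`, the `k`-th moment of `μ n` is `r ^ α` times the Laplace transform at
  -- `(k + 1) * r`, so it tends to `c * (k + 1) ^ (-α)`. These are the moments of `c` times the law
  -- of `e^{-t}` for `t` Gamma distributed.
  set μ : ℕ → Measure ℝ := fun n => Measure.sum fun m : ℕ =>
    ENNReal.ofReal (w n m) • Measure.dirac (Real.exp (-(r n * m))) with hμdef
  have hμint : ∀ n (f : ℝ → ℝ), ∫ x, f x ∂μ n = ∑' m : ℕ, w n m * f (Real.exp (-(r n * m))) := by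
    intro n f
    rw [hμdef, integral_sum_dirac fun _ => ENNReal.ofReal_ne_top]
    simp only [ENNReal.toReal_ofReal (hw0 n _), smul_eq_mul]
  have hμfin : ∀ n, IsFiniteMeasure (μ n) := fun n => ⟨by
    have : ∑' m, ENNReal.ofReal (w n m) ≠ ⊤ :=
      ((hs (r n) (hr0 n)).mul_left (r n ^ α)).tsum_ofReal_ne_top
    simpa [hμdef, Measure.sum_apply _ MeasurableSet.univ] using lt_top_iff_ne_top.2 this⟩
  have hμsupp : ∀ n, ∀ᵐ x ∂μ n, x ∈ Set.Icc (0 : ℝ) 1 := fun n => by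
    rw [hμdef, Measure.ae_sum_iff]
    intro m
    refine Measure.ae_smul_measure ?_ _
    refine (ae_dirac_iff (p := (· ∈ Set.Icc (0 : ℝ) 1)) measurableSet_Icc).2 ?_
    exact ⟨(Real.exp_pos _).le, Real.exp_le_one_iff.2
      (neg_nonpos.2 (mul_nonneg (hr0 n).le (Nat.cast_nonneg m)))⟩
  have := ProbabilityTheory.isProbabilityMeasure_gammaMeasure hα one_pos
  have hexp : Measurable fun t : ℝ => Real.exp (-t) := Real.measurable_exp.comp measurable_neg
  set ν : Measure ℝ := ENNReal.ofReal c •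
    (ProbabilityTheory.gammaMeasure α 1).map (fun t : ℝ => Real.exp (-t)) with hνdef
  have hνfin : IsFiniteMeasure ν := by
    have : IsFiniteMeasure
        ((ProbabilityTheory.gammaMeasure α 1).map (fun t : ℝ => Real.exp (-t))) := inferInstance
    exact Measure.smul_finite _ ENNReal.ofReal_ne_top
  have hνint : ∀ f : ℝ → ℝ, Measurable f →
      ∫ x, f x ∂ν = c * ∫ t, f (Real.exp (-t)) ∂ProbabilityTheory.gammaMeasure α 1 := by
    intro f hf
    rw [hνdef, integral_smul_measure, ENNReal.toReal_ofReal hc, smul_eq_mul,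
      integral_map hexp.aemeasurable hf.aestronglyMeasurable]
  have hνsupp : ∀ᵐ x ∂ν, x ∈ Set.Icc (0 : ℝ) 1 := by
    refine Measure.ae_smul_measure ?_ _
    refine (ae_map_iff (p := (· ∈ Set.Icc (0 : ℝ) 1)) hexp.aemeasurable measurableSet_Icc).2 ?_
    filter_upwards [ae_nonneg_gammaMeasure α 1] with t ht
    exact ⟨(Real.exp_pos _).le, Real.exp_le_one_iff.2 (neg_nonpos.2 ht)⟩
  have hmom : ∀ k : ℕ, Tendsto (fun n => ∫ x, x ^ k ∂μ n) atTop (𝓝 (∫ x, x ^ k ∂ν)) := by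
    intro k
    have hk : (0 : ℝ) < k + 1 := by positivity
    rw [hνint (fun x => x ^ k) (measurable_id.pow_const k), integral_exp_neg_pow_gammaMeasure hα, mul_comm]
    have h1 : Tendsto (fun n => ((k : ℝ) + 1) * r n) atTop (𝓝[>] 0) := by
      refine tendsto_nhdsWithin_iff.2 ⟨by simpa using hrlim.const_mul ((k : ℝ) + 1), ?_⟩
      exact Eventually.of_forall fun n => mul_pos hk (hr0 n)
    refine ((hlim.comp h1).const_mul (((k : ℝ) + 1) ^ (-α))).congr fun n => ?_
    rw [hμint, Function.comp_apply, Real.mul_rpow hk.le (hr0 n).le, ← mul_assoc, ← mul_assoc,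
      ← Real.rpow_add hk, neg_add_cancel, Real.rpow_zero, one_mul, ← tsum_mul_left]
    refine tsum_congr fun m => ?_
    rw [hw, ← Real.exp_nat_mul]
    simp only
    rw [mul_assoc (r n ^ α), mul_assoc (u m), ← Real.exp_add]
    congr 3
    ring
  have hνcut : ∀ θ : ℝ, 0 ≤ θ → ∫ x, cutoffInv θ x ∂ν = c * (θ ^ α / Real.Gamma (α + 1)) :=
    fun θ hθ => by
      rw [hνint _ (measurable_cutoffInv θ), integral_cutoffInv_exp_neg_gammaMeasure hα hθ]
  have hcont : ContinuousAt (fun θ => ∫ x, cutoffInv θ x ∂ν) 1 := by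
    have : ContinuousAt (fun θ : ℝ => c * (θ ^ α / Real.Gamma (α + 1))) 1 :=
      ((Real.continuousAt_rpow_const _ _ (Or.inl one_ne_zero)).div_const _).const_mul c
    refine this.congr ?_
    filter_upwards [lt_mem_nhds (zero_lt_one (α := ℝ))] with θ hθ
    exact (hνcut θ hθ.le).symm
  have hfin := tendsto_integral_cutoffInv hμsupp hνsupp hmom hcont
  rw [hνcut 1 zero_le_one, Real.one_rpow, mul_one_div] at hfin
  -- Threshold `1` keeps exactly the `m ≤ n + 1` and cancels their exponential weights, so the
  -- integral is the claimed quotient at `n + 1`.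
  rw [← tendsto_add_atTop_iff_nat 1]
  refine hfin.congr fun n => ?_
  rw [hμint, tsum_eq_sum (s := Finset.range (n + 1 + 1)), Finset.sum_div]
  · refine Finset.sum_congr rfl fun m hm => ?_
    have hmn : (m : ℝ) ≤ n + 1 := by exact_mod_cast Nat.lt_succ_iff.1 (Finset.mem_range.1 hm)
    have : r n * m ≤ 1 := by
      simp only [hr]
      rw [one_div, inv_mul_le_one₀ (by positivity)]
      exact hmn
    rw [cutoffInv, if_pos (Real.exp_le_exp.2 (neg_le_neg this)), hw]
    simp only [hr]
    rw [Real.div_rpow zero_le_one (by positivity), Real.one_rpow]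
    have := (Real.exp_pos (-(1 / ((n : ℝ) + 1) * m))).ne'
    push_cast
    field_simp
  · intro m hm
    have hmn : (n : ℝ) + 1 < m := by
      have : n + 1 + 1 ≤ m := not_lt.1 fun h => hm (Finset.mem_range.2 h)
      exact_mod_cast this
    have : ¬ r n * m ≤ 1 := by
      simp only [hr]
      rw [one_div, inv_mul_le_one₀ (by positivity)]
      exact not_le.2 hmn
    rw [cutoffInv, if_neg, mul_zero]
    rwa [Real.exp_le_exp, neg_le_neg_iff]

/-- The Abelian theorem for step functions with regularly varying values. -/
lemma tendsto_rpow_mul_integral_floor {p : ℕ → ℝ} (hp : ∀ n, |p n| ≤ 1) {α A : ℝ} (hα : 0 ≤ α)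
    (hα1 : α < 1) (hlim : Tendsto (fun x : ℝ => p ⌊x⌋₊ * x ^ α) atTop (𝓝 A)) :
    Tendsto (fun r : ℝ => r ^ (1 - α) * ∫ x in Set.Ioi 0, p ⌊x⌋₊ * Real.exp (-(r * x)))
      (𝓝[>] 0) (𝓝 (A * Real.Gamma (1 - α))) := by
  -- Domination: convergence bounds the product for large `x`, and `|p| ≤ 1` bounds it for small
  -- `x`.
  obtain ⟨C, hC⟩ : ∃ C, ∀ x : ℝ, 0 < x → |p ⌊x⌋₊ * x ^ α| ≤ C := by
    obtain ⟨X, hX⟩ := eventually_atTop.1 (hlim.abs.eventually (gt_mem_nhds (lt_add_one |A|)))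
    refine ⟨max (|A| + 1) (|X| ^ α), fun x hx => ?_⟩
    rcases le_total X x with h | h
    · exact (hX x h).le.trans (le_max_left _ _)
    · refine le_trans ?_ (le_max_right _ _)
      rw [abs_mul, abs_of_nonneg (Real.rpow_nonneg hx.le α)]
      refine (mul_le_of_le_one_left (Real.rpow_nonneg hx.le α) (hp _)).trans ?_
      exact Real.rpow_le_rpow hx.le (h.trans (le_abs_self X)) hα
  have hmeas : Measurable fun x : ℝ => p ⌊x⌋₊ := (measurable_of_countable p).comp Nat.measurable_floor
  have hint : Integrable (fun t : ℝ => C * (Real.exp (-t) * t ^ ((1 - α) - 1)))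
      (volume.restrict (Set.Ioi 0)) :=
    (Real.GammaIntegral_convergent (sub_pos.2 hα1)).const_mul C
  -- This is the integral after the substitution `x = t / r`.
  have key : Tendsto (fun r : ℝ => ∫ t in Set.Ioi 0,
      (p ⌊r⁻¹ * t⌋₊ * (r⁻¹ * t) ^ α) * (Real.exp (-t) * t ^ ((1 - α) - 1))) (𝓝[>] 0)
      (𝓝 (∫ t in Set.Ioi 0, A * (Real.exp (-t) * t ^ ((1 - α) - 1)))) := by
    refine tendsto_integral_filter_of_dominated_convergence _ ?_ ?_ hint ?_
    · refine Eventually.of_forall fun r => Measurable.aestronglyMeasurable ?_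
      have : Measurable fun t : ℝ => p ⌊r⁻¹ * t⌋₊ := hmeas.comp (measurable_const_mul r⁻¹)
      fun_prop
    · filter_upwards [self_mem_nhdsWithin] with r hr
      filter_upwards [ae_restrict_mem measurableSet_Ioi] with t ht
      have h1 : 0 ≤ Real.exp (-t) * t ^ ((1 - α) - 1) :=
        mul_nonneg (Real.exp_pos _).le (Real.rpow_nonneg (le_of_lt ht) _)
      rw [norm_mul, Real.norm_eq_abs, Real.norm_eq_abs, abs_of_nonneg h1]
      exact mul_le_mul_of_nonneg_right (hC _ (mul_pos (inv_pos.2 hr) ht)) h1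
    · filter_upwards [ae_restrict_mem measurableSet_Ioi] with t ht
      exact (hlim.comp (tendsto_inv_nhdsGT_zero.atTop_mul_const ht)).mul_const _
  rw [integral_const_mul, ← Real.Gamma_eq_integral (sub_pos.2 hα1)] at key
  refine key.congr' ?_
  filter_upwards [self_mem_nhdsWithin] with r hr
  have hr : 0 < r := hr
  have := integral_comp_mul_left_Ioi (fun t : ℝ => p ⌊r⁻¹ * t⌋₊ * Real.exp (-t)) 0 hr
  simp only [inv_mul_cancel_left₀ hr.ne', mul_zero, smul_eq_mul] at this
  rw [this, ← mul_assoc, ← integral_const_mul]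
  refine setIntegral_congr_fun measurableSet_Ioi fun t ht => ?_
  have ht : 0 < t := ht
  rw [Real.mul_rpow (inv_pos.2 hr).le ht.le, Real.inv_rpow hr.le, Real.rpow_sub hr, Real.rpow_one,
    show (1 - α) - 1 = -α by ring, Real.rpow_neg ht.le]
  have h1 := (Real.rpow_pos_of_pos hr α).ne'
  have h2 := (Real.rpow_pos_of_pos ht α).ne'
  field_simp

/-- Integration over each `[n, n + 1)` links the integral of the Abelian theorem with the series in
the renewal identity. -/
lemma integral_floor_mul_exp {p : ℕ → ℝ} (hp : ∀ n, |p n| ≤ 1) {r : ℝ} (hr : 0 < r) :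
    r * ∫ x in Set.Ioi 0, p ⌊x⌋₊ * Real.exp (-(r * x)) =
      (1 - Real.exp (-r)) * ∑' n : ℕ, p n * Real.exp (-(r * n)) := by
  have hmeas : Measurable fun x : ℝ => p ⌊x⌋₊ := (measurable_of_countable p).comp Nat.measurable_floor
  have hU : (⋃ n : ℕ, Set.Ico (n : ℝ) ((n + 1 : ℕ) : ℝ)) = Set.Ici 0 := by
    have := iUnion_Ico_map_succ_eq_Ici (f := fun n : ℕ => (n : ℝ)) (fun a => by simp)
      (by rw [not_bddAbove_iff]
          exact fun x => let ⟨n, hn⟩ := exists_nat_gt x; ⟨n, ⟨n, rfl⟩, hn⟩)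
    simpa using this
  have hint : IntegrableOn (fun x : ℝ => p ⌊x⌋₊ * Real.exp (-(r * x)))
      (⋃ n : ℕ, Set.Ico (n : ℝ) ((n + 1 : ℕ) : ℝ)) := by
    rw [hU, integrableOn_Ici_iff_integrableOn_Ioi]
    have h1 : IntegrableOn (fun x : ℝ => Real.exp (-(r * x))) (Set.Ioi 0) := by
      simpa [neg_mul] using integrableOn_exp_mul_Ioi (neg_lt_zero.2 hr) 0
    refine h1.bdd_mul hmeas.aestronglyMeasurable (c := 1) (Eventually.of_forall fun x => ?_)
    exact hp _
  have hsum := hasSum_integral_iUnion (fun n : ℕ => measurableSet_Ico)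
    (Nat.mono_cast (α := ℝ)).pairwise_disjoint_on_Ico_succ hint
  simp only [Nat.succ_eq_succ, Nat.succ_eq_add_one] at hsum
  rw [hU, integral_Ici_eq_integral_Ioi] at hsum
  rw [← hsum.tsum_eq, ← tsum_mul_left, ← tsum_mul_left]
  refine tsum_congr fun n => ?_
  have e1 : ∫ x in Set.Ico (n : ℝ) ((n + 1 : ℕ) : ℝ), p ⌊x⌋₊ * Real.exp (-(r * x)) =
      ∫ x in Set.Ico (n : ℝ) ((n + 1 : ℕ) : ℝ), p n * Real.exp (-r * x) := by
    refine setIntegral_congr_fun measurableSet_Ico fun x hx => ?_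
    have : ⌊x⌋₊ = n := (Nat.floor_eq_iff ((Nat.cast_nonneg n).trans hx.1)).2
      ⟨hx.1, by simpa using hx.2⟩
    simp only [this, neg_mul]
  have e2 : ∫ x in (n : ℝ)..((n + 1 : ℕ) : ℝ), Real.exp (-r * x) =
      r⁻¹ * (Real.exp (-(r * n)) - Real.exp (-(r * n)) * Real.exp (-r)) := by
    rw [intervalIntegral.integral_comp_mul_left (fun x => Real.exp x) (neg_ne_zero.2 hr.ne'),
      integral_exp, smul_eq_mul, ← Real.exp_add]
    have : -r * ((n + 1 : ℕ) : ℝ) = -(r * n) + -r := by push_cast; ring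
    rw [this, neg_mul, inv_neg]
    ring
  rw [e1, integral_const_mul, integral_Ico_eq_integral_Ioc,
    ← intervalIntegral.integral_of_le (by push_cast; linarith), e2]
  field_simp

lemma summable_mul_exp_neg {p : ℕ → ℝ} (hp : ∀ n, |p n| ≤ 1) {r : ℝ} (hr : 0 < r) :
    Summable fun n : ℕ => p n * Real.exp (-(r * n)) := by
  refine Summable.of_norm_bounded (g := fun n : ℕ => Real.exp (-r) ^ n)
    (summable_geometric_of_lt_one (Real.exp_pos _).le (Real.exp_lt_one_iff.2 (neg_lt_zero.2 hr))) fun n => ?_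
  rw [norm_mul, Real.norm_eq_abs, Real.norm_eq_abs, abs_of_pos (Real.exp_pos _),
    ← Real.exp_nat_mul]
  refine (mul_le_of_le_one_left (Real.exp_pos _).le (hp n)).trans (le_of_eq ?_)
  congr 1
  ring

/-! ### Regularly varying tails. -/

lemma abs_pt_le_one {ε : ℕ → ℝ} (h : IsPLSeq ε) (n : ℕ) : |pt ε n| ≤ 1 := by
  rw [abs_of_pos (h.pt_pos n)]; exact h.pt_le_one n

lemma abs_renewalMass_le_one {ε : ℕ → ℝ} (h : IsPLSeq ε) (n : ℕ) : |renewalMass ε n| ≤ 1 := by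
  rw [abs_of_nonneg (renewalMass_nonneg h n)]; exact renewalMass_le_one h n

/-- By the last-renewal identity the Cauchy product of the two series is the geometric series in
`e^{-r}`. -/
lemma tsum_pt_mul_tsum_renewalMass {ε : ℕ → ℝ} (h : IsPLSeq ε) {r : ℝ} (hr : 0 < r) :
    (1 - Real.exp (-r)) * (∑' n : ℕ, pt ε n * Real.exp (-(r * n))) *
      ∑' n : ℕ, renewalMass ε n * Real.exp (-(r * n)) = 1 := by
  have h1 : Real.exp (-r) < 1 := Real.exp_lt_one_iff.2 (neg_lt_zero.2 hr)
  rw [mul_assoc, tsum_mul_tsum_eq_tsum_sum_range_of_summable_norm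
    (summable_mul_exp_neg (abs_pt_le_one h) hr).norm
    (summable_mul_exp_neg (abs_renewalMass_le_one h) hr).norm]
  have : ∀ n : ℕ, ∑ k ∈ Finset.range (n + 1), pt ε k * Real.exp (-(r * k)) *
      (renewalMass ε (n - k) * Real.exp (-(r * (n - k : ℕ)))) = Real.exp (-r) ^ n := fun n => by
    rw [← one_mul (Real.exp (-r) ^ n), ← sum_pt_mul_renewalMass h n, Finset.sum_mul]
    refine Finset.sum_congr rfl fun k hk => ?_
    rw [mul_mul_mul_comm, ← Real.exp_add, ← Real.exp_nat_mul]
    congr 2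
    rw [Nat.cast_sub (Nat.lt_succ_iff.1 (Finset.mem_range.1 hk))]
    ring
  simp only [this]
  rw [tsum_geometric_of_lt_one (Real.exp_pos _).le h1, mul_inv_cancel₀ (by linarith)]

lemma tendsto_renewalSum_div_rpow {ε : ℕ → ℝ} (h : IsPLSeq ε) {A α : ℝ} (hA : 0 < A)
    (hα : 0 < α) (hα1 : α < 1)
    (hlim : Tendsto (fun x : ℝ => pt ε ⌊x⌋₊ * x ^ α) atTop (𝓝 A)) :
    Tendsto (fun n : ℕ => renewalSum ε n / (n : ℝ) ^ α) atTop
      (𝓝 (Real.sin (α * Real.pi) / (A * α * Real.pi))) := by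
  have hG : 0 < Real.Gamma (1 - α) := Real.Gamma_pos_of_pos (by linarith)
  have hG' : 0 < Real.Gamma α := Real.Gamma_pos_of_pos hα
  have h1 := (tendsto_rpow_mul_integral_floor (abs_pt_le_one h) hα.le hα1 hlim).inv₀
    (mul_pos hA hG).ne'
  have h2 : Tendsto (fun r : ℝ => r ^ α * ∑' m : ℕ, renewalMass ε m * Real.exp (-(r * m)))
      (𝓝[>] 0) (𝓝 (A * Real.Gamma (1 - α))⁻¹) := by
    refine h1.congr' ?_
    filter_upwards [self_mem_nhdsWithin] with r hr
    have hr : 0 < r := hr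
    have e := tsum_pt_mul_tsum_renewalMass h hr
    rw [← integral_floor_mul_exp (abs_pt_le_one h) hr] at e
    refine inv_eq_of_mul_eq_one_right ?_
    refine Eq.trans ?_ e
    rw [Real.rpow_sub hr, Real.rpow_one]
    have := (Real.rpow_pos_of_pos hr α).ne'
    field_simp
  have h3 := tendsto_sum_div_rpow_of_tendsto_laplace (renewalMass_nonneg h)
    (fun r hr => summable_mul_exp_neg (abs_renewalMass_le_one h) hr) hα h2
  simp only [sum_renewalMass] at h3
  have e : (A * Real.Gamma (1 - α))⁻¹ / Real.Gamma (α + 1) =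
      Real.sin (α * Real.pi) / (A * α * Real.pi) := by
    have hsin : 0 < Real.sin (Real.pi * α) :=
      Real.sin_pos_of_pos_of_lt_pi (by positivity) (by nlinarith [Real.pi_pos])
    have h4 := Real.Gamma_mul_Gamma_one_sub α
    rw [eq_div_iff hsin.ne'] at h4
    rw [Real.Gamma_add_one hα.ne', mul_comm α Real.pi, inv_eq_one_div, div_div,
      div_eq_div_iff (by positivity) (by positivity)]
    linear_combination -(A * α) * h4
  rwa [e] at h3

lemma pos_of_tail_isEquivalent {ε : ℕ → ℝ} (h : IsPLSeq ε) {A α : ℝ}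
    (ht : (fun x : ℝ => pt ε ⌊x⌋₊) ~[atTop] fun x : ℝ => A * x ^ (-α)) :
    Tendsto (fun x : ℝ => pt ε ⌊x⌋₊ * x ^ α) atTop (𝓝 A) ∧ 0 < A := by
  have hlim : Tendsto (fun x : ℝ => pt ε ⌊x⌋₊ * x ^ α) atTop (𝓝 A) := by
    have h1 := ht.mul (IsEquivalent.refl (u := fun x : ℝ => x ^ α) (l := atTop))
    refine h1.symm.tendsto_nhds (tendsto_const_nhds.congr' ?_)
    filter_upwards [eventually_gt_atTop 0] with x hx
    simp only [Pi.mul_apply]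
    rw [mul_assoc, ← Real.rpow_add hx, neg_add_cancel, Real.rpow_zero, mul_one]
  refine ⟨hlim, lt_of_le_of_ne ?_ ?_⟩
  · refine ge_of_tendsto hlim ?_
    filter_upwards [eventually_gt_atTop 0] with x hx
    exact mul_nonneg (h.pt_pos _).le (Real.rpow_nonneg hx.le _)
  -- Equivalence to zero means being eventually zero, which `pt` never is.
  · rintro rfl
    simp only [zero_mul] at ht
    obtain ⟨x, hx⟩ := (isEquivalent_zero_iff_eventually_zero.1 ht).exists
    exact (h.pt_pos _).ne' hx

lemma tail_isEquivalent_natCast {ε : ℕ → ℝ} {g : ℝ → ℝ}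
    (ht : (fun x : ℝ => pt ε ⌊x⌋₊) ~[atTop] g) : pt ε ~[atTop] fun n : ℕ => g n := by
  have := ht.comp_tendsto tendsto_natCast_atTop_atTop
  simpa [Function.comp_def] using this

lemma summable_pt_iff {ε : ℕ → ℝ} {g : ℝ → ℝ} (ht : (fun x : ℝ => pt ε ⌊x⌋₊) ~[atTop] g) :
    Summable (pt ε) ↔ Summable fun n : ℕ => g n :=
  ⟨fun hs => summable_of_isBigO_nat hs (tail_isEquivalent_natCast ht).isBigO_symm,
    fun hs => summable_of_isBigO_nat hs (tail_isEquivalent_natCast ht).isBigO⟩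

lemma not_summable_one_div_log : ¬ Summable fun n : ℕ => 1 / Real.log n := fun hs => by
  refine Real.not_summable_natCast_inv (summable_of_isBigO_nat hs (IsBigO.of_bound 1 ?_))
  filter_upwards [eventually_gt_atTop 1] with n hn
  have h1 : (1 : ℝ) < n := by exact_mod_cast hn
  have h2 := Real.log_pos h1
  rw [one_mul, Real.norm_eq_abs, Real.norm_eq_abs, abs_of_pos (by positivity),
    abs_of_pos (by positivity), one_div]
  exact inv_anti₀ h2 ((Real.log_le_sub_one_of_pos (by linarith)).trans (by linarith))

end PL

end

theorem mainTheorem7 (ε : ℕ → ℝ) (hε : PL.IsPLSeq ε) :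
    (PL.meanRecurrenceTime ε < ⊤ →
      (fun n : ℕ => PL.meanPassages ε n) ~[atTop]
        (fun n : ℕ => (n : ℝ) / (PL.meanRecurrenceTime ε).toReal)) ∧
    (PL.meanRecurrenceTime ε = ⊤ →
      Tendsto (fun n : ℕ => PL.meanPassages ε n) atTop atTop ∧
      (fun n : ℕ => PL.meanPassages ε n) =o[atTop] (fun n : ℕ => (n : ℝ))) ∧
    (∀ A α : ℝ,
      (fun x : ℝ => 1 - PL.recurrenceCDF ε x) ~[atTop] (fun x : ℝ => A * x ^ (-α)) →
      (1 < α → PL.meanRecurrenceTime ε < ⊤) ∧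
      (0 < α → α < 1 →
        PL.meanRecurrenceTime ε = ⊤ ∧
        (fun n : ℕ => PL.meanPassages ε n) ~[atTop]
          (fun n : ℕ => Real.sin (α * Real.pi) / (A * α * Real.pi) * (n : ℝ) ^ α) ∧
        ∀ b : ℕ → ℝ, b =o[atTop] (fun n : ℕ => PL.meanPassages ε n) →
          Tendsto (fun n : ℕ => PL.leb {x : ℝ | (PL.passages n (PL.symb ε x) : ℝ) ≤ b n})
            atTop (𝓝 0))) ∧
    ((fun x : ℝ => 1 - PL.recurrenceCDF ε x) ~[atTop] (fun x : ℝ => 1 / Real.log x) →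
      PL.meanRecurrenceTime ε = ⊤ ∧
      (fun n : ℕ => PL.meanPassages ε n) ~[atTop] (fun n : ℕ => Real.log (n : ℝ))) := by
  have htop : PL.meanRecurrenceTime ε = ⊤ ↔ ¬ Summable (PL.pt ε) := by
    rw [← PL.meanRecurrenceTime_lt_top_iff hε, not_lt_top_iff]
  simp only [PL.one_sub_recurrenceCDF]
  refine ⟨fun ht => ?_, fun ht => ?_, fun A α hF => ?_, fun hF => ?_⟩
  · exact PL.meanPassages_isEquivalent_of_summable hε
      ((PL.meanRecurrenceTime_lt_top_iff hε).1 ht)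
  · exact ⟨PL.tendsto_meanPassages hε, PL.meanPassages_isLittleO hε (htop.1 ht)⟩
  · obtain ⟨hlim, hA⟩ := PL.pos_of_tail_isEquivalent hε hF
    have hsum : Summable (PL.pt ε) ↔ 1 < α := by
      rw [PL.summable_pt_iff hF, summable_mul_left_iff hA.ne', Real.summable_nat_rpow,
        neg_lt_neg_iff]
    refine ⟨fun hα => (PL.meanRecurrenceTime_lt_top_iff hε).2 (hsum.2 hα), fun hα hα1 =>
      ⟨htop.2 fun hs => lt_asymm hα1 (hsum.1 hs), ?_, fun b hb => PL.tendsto_leb_visits_le hε hb⟩⟩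
    have hsin : 0 < Real.sin (α * Real.pi) :=
      Real.sin_pos_of_pos_of_lt_pi (by positivity) (by nlinarith [Real.pi_pos])
    have hc : 0 < Real.sin (α * Real.pi) / (A * α * Real.pi) := by positivity
    refine (PL.meanPassages_isEquivalent_renewalSum hε).trans
      ((isEquivalent_iff_tendsto_one ?_).2 ?_)
    · filter_upwards [eventually_ne_atTop 0] with n hn
      positivity
    · have := (PL.tendsto_renewalSum_div_rpow hε hA hα hα1 hlim).div_const
        (Real.sin (α * Real.pi) / (A * α * Real.pi))
      rw [div_self hc.ne'] at this
      refine this.congr fun n => ?_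
      rw [Pi.div_apply, div_div, mul_comm]
  · refine ⟨htop.2 fun hs => PL.not_summable_one_div_log ((PL.summable_pt_iff hF).1 hs),
      PL.meanPassages_isEquivalent_log hε ?_⟩
    have h1 := hF.mul (IsEquivalent.refl (u := fun x : ℝ => Real.log x) (l := atTop))
    refine h1.symm.tendsto_nhds (tendsto_const_nhds.congr' ?_)
    filter_upwards [eventually_gt_atTop 1] with x hx
    simp only [Pi.mul_apply]
    rw [one_div, inv_mul_cancel₀ (Real.log_pos hx).ne']
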